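/- Let $G$ be a finite group. A $G$-semi-Tambara functor is a product-preserving functor $F:\mathcal P_G\to\mathsf{Set}$, where $\mathcal P_G$ is the category whose objects are finite $G$-sets and whose morphisms $X\to Y$ are isomorphism classes of bispans $X\leftarrow A\to B\to Y$ of finite $G$-sets. Equivalently, $F$ assigns a set $F(X)$ to each finite $G$-set $X$, and transfers $T_f:F(X)\to F(Y)$, norms $N_f:F(X)\to F(Y)$ and restrictions $R_f:F(Y)\to F(X)$ to each equivariant map $f:X\to Y$. Each class is functorial; transfers and norms satisfy base change with restrictions along pullback squares; $N_g\circ T_f=T_{\Pi_g f}\circ N_{g'}\circ R_{\varepsilon}$ for $X\xrightarrow{f}Y\xrightarrow{g}Z$, where $\Pi_g f$ is the dependent product, $g':g^*\Pi_g f\to\Pi_g f$ is the projection and $\varepsilon:g^*\Pi_g f\to X$ is the counit; and $F(\varnothing)$ is a point and $F(X\amalg Y)\cong F(X)\times F(Y)$ via the restrictions along the two inclusions. Under this identification, $T_\nabla$ and $N_\nabla$, for the codiagonal $\nabla:X\amalg X\to X$, make $F(X)$ a commutative semiring. A $G$-Tambara functor is a $G$-semi-Tambara functor $F$ for which every $F(X)$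 is a ring (that is, has additive inverses). Morphisms are natural transformations. The free $G$-Tambara functor $\mathcal A[x_G]$ on one generator at level $G/G$ is the $G$-Tambara functor, with an element $x\in\mathcal A[x_G](G/G)$, such that for every $G$-Tambara functor $K$ and every $b\in K(G/G)$ there is a unique morphism $\mathcal A[x_G]\to K$ sending $x$ to $b$. \textbf{Theorem.} For every finite group $G$, the free $G$-Tambara functor $\mathcal A[x_G]$ exists, and for every subgroup $H\le G$ the commutative ring $\mathcal A[x_G](G/H)$ is finitely generated (as a ring, i.e. as a $\mathbb Z$-algebra). -/

import Mathlib

universe u v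

/-- A finite `G`-set. -/
structure FinGSet (G : Type u) [Group G] : Type (u + 1) where
  carrier : Type u
  [action : MulAction G carrier]
  [finite : Finite carrier]

namespace FinGSet

variable {G : Type u} [Group G]

instance : CoeSort (FinGSet.{u} G) (Type u) := ⟨carrier⟩

attribute [instance] action finite

/-- The empty `G`-set. -/
def empty (G : Type u) [Group G] : FinGSet.{u} G where
  carrier := PEmpty.{u + 1}
  action := { smul := fun _ x => x, one_smul := fun x => x.elim, mul_smul := fun _ _ x => x.elim }
  finite := inferInstance

instance : IsEmpty (empty G) := inferInstanceAs (IsEmpty PEmpty.{u + 1})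

/-- The unique equivariant map out of the empty `G`-set. -/
def fromEmpty (X : FinGSet.{u} G) : empty G →[G] X where
  toFun := isEmptyElim
  map_smul' := fun _ => isEmptyElim

/-- The disjoint union of two finite `G`-sets. -/
abbrev sum (X Y : FinGSet.{u} G) : FinGSet.{u} G := ⟨X ⊕ Y⟩

/-- The first inclusion into a disjoint union. -/
def inl (X Y : FinGSet.{u} G) : X →[G] X.sum Y where
  toFun := Sum.inl
  map_smul' := fun _ _ => rfl

/-- The second inclusion into a disjoint union. -/
def inr (X Y : FinGSet.{u} G) : Y →[G] X.sum Y where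
  toFun := Sum.inr
  map_smul' := fun _ _ => rfl

/-- The map out of a disjoint union with given restrictions to the two summands. -/
def desc {X Y Z : FinGSet.{u} G} (f : X →[G] Z) (g : Y →[G] Z) : X.sum Y →[G] Z where
  toFun := Sum.elim f g
  map_smul' := by rintro m (x | y) <;> simp

/-- The codiagonal `∇ : X ⨿ X → X`. -/
def fold (X : FinGSet.{u} G) : X.sum X →[G] X := desc (.id G) (.id G)

/-- The transitive `G`-set `G/H`. -/
abbrev orbit [Finite G] (H : Subgroup G) : FinGSet.{u} G := ⟨G ⧸ H⟩

/-- The square with top `f' : W → Y`, left side `g' : W → X`, bottom `f : X → Z` and right side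
`g : Y → Z` is a pullback square. -/
def IsPullbackSq {W X Y Z : FinGSet.{u} G} (f' : W →[G] Y) (g' : W →[G] X) (f : X →[G] Z)
    (g : Y →[G] Z) : Prop :=
  (∀ w, f (g' w) = g (f' w)) ∧ ∀ x y, f x = g y → ∃! w, g' w = x ∧ f' w = y

section DependentProduct

variable {X Y Z : FinGSet.{u} G} (f : X →[G] Y) (g : Y →[G] Z)

/-- The set underlying the dependent product `Π_g f`: pairs `(z, t)` of a point `z` of `Z` and a
section `t` of `f` over the fibre of `g` at `z`. -/
abbrev PiCarrier : Type u :=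
  Σ z : Z, {t : {y : Y // g y = z} → X // ∀ y, f (t y) = y}

variable {f g} in
theorem PiCarrier.ext' {p q : PiCarrier f g} (h : p.1 = q.1)
    (h' : ∀ y hp hq, p.2.1 ⟨y, hp⟩ = q.2.1 ⟨y, hq⟩) : p = q := by
  obtain ⟨z, t, ht⟩ := p
  obtain ⟨z', t', ht'⟩ := q
  obtain rfl : z = z' := h
  congr 2
  funext ⟨y, hy⟩
  exact h' y hy hy

/-- The action `γ (z, t) = (γ z, y ↦ γ t(γ⁻¹ y))`. -/
instance piAction : MulAction G (PiCarrier f g) where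
  smul γ p := ⟨γ • p.1, fun y => γ • p.2.1 ⟨γ⁻¹ • y.1, by rw [map_smul, y.2, inv_smul_smul]⟩,
    fun y => by rw [map_smul, p.2.2, smul_inv_smul]⟩
  one_smul p := by
    refine PiCarrier.ext' (one_smul _ _) fun y hp hq => ?_
    change (1 : G) • p.2.1 ⟨(1 : G)⁻¹ • y, _⟩ = _
    simp
  mul_smul a b p := by
    refine PiCarrier.ext' (mul_smul _ _ _) fun y hp hq => ?_
    change (a * b) • p.2.1 ⟨(a * b)⁻¹ • y, _⟩ = a • b • p.2.1 ⟨b⁻¹ • a⁻¹ • y, _⟩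
    simp [mul_smul]

/-- The finite `G`-set `Π_g f`. -/
abbrev piSet : FinGSet.{u} G := ⟨PiCarrier f g⟩

/-- The structure map `Π_g f → Z`, `(z, t) ↦ z`. -/
def piMap : piSet f g →[G] Z where
  toFun p := p.1
  map_smul' _ _ := rfl

/-- The action on the pullback `g^* Π_g f`, inherited from the product. -/
instance piPullbackAction : MulAction G {e : Y × piSet f g // g e.1 = piMap f g e.2} where
  smul γ e := ⟨γ • e.1, by
    change g (γ • e.1.1) = piMap f g (γ • e.1.2)
    rw [map_smul, map_smul, e.2]⟩
  one_smul e := Subtype.ext (one_smul _ _)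
  mul_smul a b e := Subtype.ext (mul_smul _ _ _)

/-- The finite `G`-set `g^* Π_g f = Y ×_Z Π_g f`. -/
abbrev piPullback : FinGSet.{u} G := ⟨{e : Y × piSet f g // g e.1 = piMap f g e.2}⟩

/-- The projection `g' : g^* Π_g f → Π_g f`. -/
def piPullbackSnd : piPullback f g →[G] piSet f g where
  toFun e := e.1.2
  map_smul' _ _ := rfl

/-- The counit `ε : g^* Π_g f → X`, `(y, (z, t)) ↦ t(y)`. -/
def piCounit : piPullback f g →[G] X where
  toFun e := e.1.2.2.1 ⟨e.1.1, e.2⟩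
  map_smul' γ e := by
    change γ • e.1.2.2.1 ⟨γ⁻¹ • γ • e.1.1, _⟩ = γ • e.1.2.2.1 ⟨e.1.1, _⟩
    simp

/-- The section of `Π_g f → Z` determined by an equivariant section of `f`. -/
def piSection (σ : Y →[G] X) (h : ∀ y, f (σ y) = y) : Z →[G] piSet f g where
  toFun z := ⟨z, fun y => σ y.1, fun y => h y.1⟩
  map_smul' γ z := PiCarrier.ext' rfl fun y hp hq => by
    change σ y = γ • σ (γ⁻¹ • y)
    rw [map_smul, smul_inv_smul]

end DependentProduct

end FinGSet

open FinGSet in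
/-- A `G`-semi-Tambara functor: a product-preserving functor to sets on the category whose objects
are the finite `G`-sets and whose morphisms are isomorphism classes of bispans
`X ← A → B → Y`. Such a functor is given by its values on objects and on the three classes of
distinguished morphisms `T_f`, `N_f`, `R_f`, subject to the rules by which these compose; finite
products in the category of bispans are disjoint unions, with projections `R_inl` and `R_inr`. -/
structure SemiTambaraFunctor (G : Type u) [Group G] : Type (max (u + 1) (v + 1)) where
  obj : FinGSet.{u} G → Type v
  T : ∀ {X Y : FinGSet.{u} G}, (X →[G] Y) → obj X → obj Y
  N : ∀ {X Y : FinGSet.{u} G}, (X →[G] Y) → obj X → obj Y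
  R : ∀ {X Y : FinGSet.{u} G}, (X →[G] Y) → obj Y → obj X
  T_id : ∀ {X : FinGSet.{u} G} (a : obj X), T (.id G) a = a
  N_id : ∀ {X : FinGSet.{u} G} (a : obj X), N (.id G) a = a
  R_id : ∀ {X : FinGSet.{u} G} (a : obj X), R (.id G) a = a
  T_comp : ∀ {X Y Z : FinGSet.{u} G} (g : Y →[G] Z) (f : X →[G] Y) (a : obj X),
    T (g.comp f) a = T g (T f a)
  N_comp : ∀ {X Y Z : FinGSet.{u} G} (g : Y →[G] Z) (f : X →[G] Y) (a : obj X),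
    N (g.comp f) a = N g (N f a)
  R_comp : ∀ {X Y Z : FinGSet.{u} G} (g : Y →[G] Z) (f : X →[G] Y) (a : obj Z),
    R (g.comp f) a = R f (R g a)
  R_T : ∀ {W X Y Z : FinGSet.{u} G} (f' : W →[G] Y) (g' : W →[G] X) (f : X →[G] Z)
    (g : Y →[G] Z), IsPullbackSq f' g' f g → ∀ a : obj X, R g (T f a) = T f' (R g' a)
  R_N : ∀ {W X Y Z : FinGSet.{u} G} (f' : W →[G] Y) (g' : W →[G] X) (f : X →[G] Z)
    (g : Y →[G] Z), IsPullbackSq f' g' f g → ∀ a : obj X, R g (N f a) = N f' (R g' a)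
  N_T : ∀ {X Y Z : FinGSet.{u} G} (f : X →[G] Y) (g : Y →[G] Z) (a : obj X),
    N g (T f a) = T (piMap f g) (N (piPullbackSnd f g) (R (piCounit f g) a))
  unique_empty : Nonempty (Unique (obj (empty G)))
  bijective_sum : ∀ X Y : FinGSet.{u} G,
    Function.Bijective fun w : obj (X.sum Y) => (R (inl X Y) w, R (inr X Y) w)

namespace SemiTambaraFunctor

open FinGSet

variable {G : Type u} [Group G] (F : SemiTambaraFunctor.{u, v} G)

/-- The bijection `F(X ⨿ Y) ≅ F(X) × F(Y)`. -/
noncomputable def sumEquiv (X Y : FinGSet.{u} G) : F.obj (X.sum Y) ≃ F.obj X × F.obj Y :=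
  Equiv.ofBijective _ (F.bijective_sum X Y)

/-- The element of `F(X ⨿ Y)` with given components in `F(X)` and `F(Y)`. -/
noncomputable def pair {X Y : FinGSet.{u} G} (a : F.obj X) (b : F.obj Y) : F.obj (X.sum Y) :=
  (F.sumEquiv X Y).symm (a, b)

/-- The element of the one-point set `F(∅)`. -/
noncomputable def emptyPt : F.obj (empty G) := F.unique_empty.some.default

section Laws

variable {F} {X Y Z W V : FinGSet.{u} G}

theorem R_pair (a : F.obj X) (b : F.obj Y) :
    F.R (inl X Y) (F.pair a b) = a ∧ F.R (inr X Y) (F.pair a b) = b := by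
  have h := (F.sumEquiv X Y).apply_symm_apply (a, b)
  exact ⟨congrArg Prod.fst h, congrArg Prod.snd h⟩

@[simp] theorem R_inl_pair (a : F.obj X) (b : F.obj Y) : F.R (inl X Y) (F.pair a b) = a :=
  (R_pair a b).1

@[simp] theorem R_inr_pair (a : F.obj X) (b : F.obj Y) : F.R (inr X Y) (F.pair a b) = b :=
  (R_pair a b).2

theorem sum_ext {w w' : F.obj (X.sum Y)} (h : F.R (inl X Y) w = F.R (inl X Y) w')
    (h' : F.R (inr X Y) w = F.R (inr X Y) w') : w = w' :=
  (F.bijective_sum X Y).1 (Prod.ext h h')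

theorem eq_pair (w : F.obj (X.sum Y)) : w = F.pair (F.R (inl X Y) w) (F.R (inr X Y) w) :=
  sum_ext (by simp) (by simp)

theorem eq_of_empty (a b : F.obj (empty G)) : a = b :=
  have := F.unique_empty.some
  Subsingleton.elim a b

/-- The formal properties shared by the transfers and the norms. -/
structure IsPushforward (F : SemiTambaraFunctor.{u, v} G)
    (M : ∀ {X Y : FinGSet.{u} G}, (X →[G] Y) → F.obj X → F.obj Y) : Prop where
  map_id : ∀ {X : FinGSet.{u} G} (a : F.obj X), M (.id G) a = a
  map_comp : ∀ {X Y Z : FinGSet.{u} G} (g : Y →[G] Z) (f : X →[G] Y) (a : F.obj X),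
    M (g.comp f) a = M g (M f a)
  R_map : ∀ {W X Y Z : FinGSet.{u} G} (f' : W →[G] Y) (g' : W →[G] X) (f : X →[G] Z)
    (g : Y →[G] Z), IsPullbackSq f' g' f g → ∀ a : F.obj X, F.R g (M f a) = M f' (F.R g' a)

theorem isPushforward_T : IsPushforward F F.T := ⟨F.T_id, F.T_comp, F.R_T⟩

theorem isPushforward_N : IsPushforward F F.N := ⟨F.N_id, F.N_comp, F.R_N⟩

namespace IsPushforward

variable {M : ∀ {X Y : FinGSet.{u} G}, (X →[G] Y) → F.obj X → F.obj Y}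

/-- Along a bijection, pushforward is inverse to restriction. -/
theorem map_R (hM : IsPushforward F M) (e : X →[G] Y) (he : Function.Bijective e)
    (a : F.obj Y) : M e (F.R e a) = a := by
  let e' : Y →[G] X := e.inverse (Function.surjInv he.2) (Function.leftInverse_surjInv he)
    (Function.rightInverse_surjInv he.2)
  have h1 : ∀ x, e' (e x) = x := Function.leftInverse_surjInv he
  have h2 : ∀ y, e (e' y) = y := Function.rightInverse_surjInv he.2
  have key : F.R (.id G) (M e (F.R e a)) = M (.id G) (F.R e' (F.R e a)) :=
    hM.R_map (.id G) e' e (.id G) ⟨fun w => h2 w, fun x y hxy =>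
      ⟨y, ⟨by rw [← h1 x]; exact congrArg e' hxy.symm, rfl⟩, fun z hz => hz.2⟩⟩ _
  rw [F.R_id, hM.map_id, ← F.R_comp] at key
  rw [key, show e.comp e' = .id G from MulActionHom.ext h2, F.R_id]

theorem map_eq_R (hM : IsPushforward F M) (e : X →[G] Y) (e' : Y →[G] X)
    (h1 : ∀ x, e' (e x) = x) (h2 : ∀ y, e (e' y) = y) (a : F.obj X) : M e a = F.R e' a := by
  have he : Function.Bijective e := ⟨Function.LeftInverse.injective h1,
    Function.RightInverse.surjective h2⟩
  rw [← hM.map_R e he (F.R e' a), ← F.R_comp, show e'.comp e = .id G from MulActionHom.ext h1,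
    F.R_id]

/-- The disjoint union of two maps acts componentwise. -/
theorem map_sum (hM : IsPushforward F M) (f : X →[G] Z) (g : Y →[G] W) (a : F.obj X)
    (b : F.obj Y) :
    M (desc ((inl Z W).comp f) ((inr Z W).comp g)) (F.pair a b) = F.pair (M f a) (M g b) := by
  refine sum_ext ?_ ?_
  · rw [R_inl_pair, hM.R_map f (inl X Y), R_inl_pair]
    refine ⟨fun w => rfl, ?_⟩
    rintro (x | y) z hz
    · exact ⟨x, ⟨rfl, Sum.inl_injective hz⟩, fun t ht => Sum.inl_injective ht.1⟩
    · exact (Sum.inr_ne_inl hz).elim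
  · rw [R_inr_pair, hM.R_map g (inr X Y), R_inr_pair]
    refine ⟨fun w => rfl, ?_⟩
    rintro (x | y) z hz
    · exact (Sum.inl_ne_inr hz).elim
    · exact ⟨y, ⟨rfl, Sum.inr_injective hz⟩, fun t ht => Sum.inr_injective ht.1⟩

theorem map_fold_comm (hM : IsPushforward F M) (a b : F.obj X) :
    M (fold X) (F.pair a b) = M (fold X) (F.pair b a) := by
  have h : M (desc (inr X X) (inl X X)) (F.pair a b) = F.pair b a := by
    rw [hM.map_eq_R _ (desc (inr X X) (inl X X)) (by rintro (x | x) <;> rfl)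
      (by rintro (x | x) <;> rfl)]
    refine sum_ext ?_ ?_ <;> rw [← F.R_comp]
    · exact (R_inr_pair a b).trans (R_inl_pair b a).symm
    · exact (R_inl_pair a b).trans (R_inr_pair b a).symm
  rw [← h, ← hM.map_comp]
  congr 1
  ext (x | x) <;> rfl

theorem map_fold_assoc (hM : IsPushforward F M) (a b c : F.obj X) :
    M (fold X) (F.pair (M (fold X) (F.pair a b)) c) =
      M (fold X) (F.pair a (M (fold X) (F.pair b c))) := by
  have h1 := hM.map_sum (fold X) (.id G) (F.pair a b) c
  have h2 := hM.map_sum (.id G) (fold X) a (F.pair b c)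
  rw [hM.map_id] at h1 h2
  rw [← h1, ← h2, ← hM.map_comp, ← hM.map_comp]
  let e : (X.sum X).sum X →[G] X.sum (X.sum X) :=
    desc (desc (inl _ _) ((inr _ _).comp (inl _ _))) ((inr _ _).comp (inr _ _))
  let e' : X.sum (X.sum X) →[G] (X.sum X).sum X :=
    desc ((inl _ _).comp (inl _ _)) (desc ((inl _ _).comp (inr _ _)) (inr _ _))
  have h : M e (F.pair (F.pair a b) c) = F.pair a (F.pair b c) := by
    rw [hM.map_eq_R e e' (by rintro ((x | x) | x) <;> rfl) (by rintro (x | x | x) <;> rfl)]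
    refine sum_ext ?_ (sum_ext ?_ ?_)
    · rw [← F.R_comp, R_inl_pair]
      change F.R ((inl (X.sum X) X).comp (inl X X)) _ = _
      rw [F.R_comp, R_inl_pair, R_inl_pair]
    · rw [← F.R_comp, ← F.R_comp, R_inr_pair, R_inl_pair]
      change F.R ((inl (X.sum X) X).comp (inr X X)) _ = _
      rw [F.R_comp, R_inl_pair, R_inr_pair]
    · rw [← F.R_comp, ← F.R_comp, R_inr_pair, R_inr_pair]
      exact R_inr_pair _ _
  rw [← h, ← hM.map_comp]
  congr 1
  ext ((x | x) | x) <;> rfl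

theorem map_fold_empty (hM : IsPushforward F M) (a : F.obj X) :
    M (fold X) (F.pair (M (fromEmpty X) F.emptyPt) a) = a := by
  have h1 := hM.map_sum (fromEmpty X) (.id G) F.emptyPt a
  rw [hM.map_id] at h1
  rw [← h1, ← hM.map_comp, hM.map_eq_R _ (inr (empty G) X), R_inr_pair]
  · rintro (x | x)
    · exact isEmptyElim x
    · rfl
  · exact fun _ => rfl

/-- Pushforward along a map that restricts to the identity on two complementary pieces. -/
theorem map_of_sections (hM : IsPushforward F M) (p : Y →[G] X) (s t : X →[G] Y)
    (hb : Function.Bijective (desc s t)) (hs : ∀ x, p (s x) = x) (ht : ∀ x, p (t x) = x)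
    (a : F.obj Y) : M p a = M (fold X) (F.pair (F.R s a) (F.R t a)) := by
  have h : F.pair (F.R s a) (F.R t a) = F.R (desc s t) a := by
    refine sum_ext ?_ ?_ <;> rw [← F.R_comp]
    · exact R_inl_pair _ _
    · exact R_inr_pair _ _
  rw [h, show fold X = p.comp (desc s t) by
      ext (x | x)
      · exact (hs x).symm
      · exact (ht x).symm,
    hM.map_comp, hM.map_R _ hb]

end IsPushforward

/-- Restriction of a norm of a transfer along the section given by an equivariant section. -/
theorem R_piSection (f : X →[G] Y) (g : Y →[G] Z) (σ : Y →[G] X) (h : ∀ y, f (σ y) = y)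
    (w : F.obj X) :
    F.R (piSection f g σ h) (F.N (piPullbackSnd f g) (F.R (piCounit f g) w)) =
      F.N g (F.R σ w) := by
  let k : Y →[G] piPullback f g :=
    { toFun := fun y => ⟨(y, piSection f g σ h (g y)), rfl⟩
      map_smul' := fun γ y => Subtype.ext (Prod.ext rfl (by
        change piSection f g σ h (g (γ • y)) = γ • piSection f g σ h (g y)
        rw [map_smul, map_smul])) }
  rw [F.R_N g k (piPullbackSnd f g) (piSection f g σ h), ← F.R_comp]
  · rfl
  · refine ⟨fun y => rfl, ?_⟩
    rintro ⟨⟨y, p⟩, hp⟩ z (rfl : p = _)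
    obtain rfl : g y = z := hp
    exact ⟨y, ⟨rfl, rfl⟩, fun t ht => congrArg (fun e => e.1.1) ht.1⟩

end Laws

noncomputable instance (X : FinGSet.{u} G) : Add (F.obj X) := ⟨fun a b => F.T (fold X) (F.pair a b)⟩

noncomputable instance (X : FinGSet.{u} G) : Mul (F.obj X) := ⟨fun a b => F.N (fold X) (F.pair a b)⟩

noncomputable instance (X : FinGSet.{u} G) : Zero (F.obj X) := ⟨F.T (fromEmpty X) F.emptyPt⟩

noncomputable instance (X : FinGSet.{u} G) : One (F.obj X) := ⟨F.N (fromEmpty X) F.emptyPt⟩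

variable {F} {X : FinGSet.{u} G}

theorem add_def (a b : F.obj X) : a + b = F.T (fold X) (F.pair a b) := rfl

theorem mul_def (a b : F.obj X) : a * b = F.N (fold X) (F.pair a b) := rfl

theorem zero_def : (0 : F.obj X) = F.T (fromEmpty X) F.emptyPt := rfl

theorem one_def : (1 : F.obj X) = F.N (fromEmpty X) F.emptyPt := rfl

protected theorem mul_add (a b c : F.obj X) : a * (b + c) = a * b + a * c := by
  have h1 := isPushforward_T.map_sum (.id G) (fold X) a (F.pair b c)
  rw [F.T_id] at h1
  rw [mul_def, add_def b c, ← h1, F.N_T]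
  let σ : X.sum X →[G] X.sum (X.sum X) := desc (inl _ _) ((inr _ _).comp (inl _ _))
  let τ : X.sum X →[G] X.sum (X.sum X) := desc (inl _ _) ((inr _ _).comp (inr _ _))
  have hσ : ∀ y, desc ((inl X X).comp (.id G)) ((inr X X).comp (fold X)) (σ y) = y := by
    rintro (x | x) <;> rfl
  have hτ : ∀ y, desc ((inl X X).comp (.id G)) ((inr X X).comp (fold X)) (τ y) = y := by
    rintro (x | x) <;> rfl
  rw [isPushforward_T.map_of_sections _ (piSection _ _ σ hσ) (piSection _ _ τ hτ) ?_
    (fun _ => rfl) (fun _ => rfl), R_piSection, R_piSection]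
  · have e1 : F.R σ (F.pair a (F.pair b c)) = F.pair a b := by
      refine sum_ext ?_ ?_ <;> rw [← F.R_comp]
      · exact (R_inl_pair _ _).trans (R_inl_pair _ _).symm
      · change F.R ((inr X (X.sum X)).comp (inl X X)) _ = _
        rw [F.R_comp, R_inr_pair, R_inl_pair, R_inr_pair]
    have e2 : F.R τ (F.pair a (F.pair b c)) = F.pair a c := by
      refine sum_ext ?_ ?_ <;> rw [← F.R_comp]
      · exact (R_inl_pair _ _).trans (R_inl_pair _ _).symm
      · change F.R ((inr X (X.sum X)).comp (inr X X)) _ = _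
        rw [F.R_comp, R_inr_pair, R_inr_pair, R_inr_pair]
    rw [e1, e2]
    rfl
  · constructor
    · rintro (x | x) (y | y) hxy
      · exact congrArg Sum.inl (congrArg Sigma.fst hxy)
      · obtain rfl : x = y := congrArg Sigma.fst hxy
        have := congrArg (fun s => s.1 ⟨Sum.inr x, rfl⟩) (eq_of_heq (Sigma.mk.inj hxy).2)
        exact (Sum.inl_ne_inr (Sum.inr_injective this)).elim
      · obtain rfl : x = y := congrArg Sigma.fst hxy
        have := congrArg (fun s => s.1 ⟨Sum.inr x, rfl⟩) (eq_of_heq (Sigma.mk.inj hxy).2)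
        exact (Sum.inr_ne_inl (Sum.inr_injective this)).elim
      · exact congrArg Sum.inr (congrArg Sigma.fst hxy)
    · rintro ⟨x, t, ht⟩
      have hl : t ⟨Sum.inl x, rfl⟩ = Sum.inl x := by
        have := ht ⟨Sum.inl x, rfl⟩
        rcases h : t ⟨Sum.inl x, rfl⟩ with y | y | y <;> rw [h] at this
        · exact congrArg Sum.inl (Sum.inl_injective this)
        · exact (Sum.inr_ne_inl this).elim
        · exact (Sum.inr_ne_inl this).elim
      have := ht ⟨Sum.inr x, rfl⟩
      rcases h : t ⟨Sum.inr x, rfl⟩ with y | y | y <;> rw [h] at this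
      · exact (Sum.inl_ne_inr this).elim
      · obtain rfl : y = x := Sum.inr_injective this
        refine ⟨Sum.inl y, PiCarrier.ext' rfl ?_⟩
        rintro (z | z) _ hz <;> obtain rfl : z = y := hz
        · exact hl.symm
        · exact h.symm
      · obtain rfl : y = x := Sum.inr_injective this
        refine ⟨Sum.inr y, PiCarrier.ext' rfl ?_⟩
        rintro (z | z) _ hz <;> obtain rfl : z = y := hz
        · exact hl.symm
        · exact h.symm

protected theorem mul_zero (a : F.obj X) : a * 0 = 0 := by
  have h1 := isPushforward_T.map_sum (.id G) (fromEmpty X) a F.emptyPt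
  rw [F.T_id] at h1
  rw [mul_def, zero_def, ← h1, F.N_T]
  set f := desc ((inl X X).comp (.id G)) ((inr X X).comp (fromEmpty X)) with hf
  have hE : ∀ p : piSet f (fold X), False := by
    rintro ⟨x, t, ht⟩
    have := ht ⟨Sum.inr x, rfl⟩
    rcases h : t ⟨Sum.inr x, rfl⟩ with y | y
    · rw [h] at this
      exact Sum.inl_ne_inr this
    · exact isEmptyElim y
  rw [← isPushforward_T.map_R (fromEmpty (piSet f (fold X)))
    ⟨fun x => isEmptyElim x, fun p => (hE p).elim⟩
    (F.N (piPullbackSnd f (fold X)) (F.R (piCounit f (fold X)) (F.pair a F.emptyPt))),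
    ← F.T_comp, eq_of_empty (F.R _ _) F.emptyPt]
  congr 1
  ext x
  exact isEmptyElim x

/-- The commutative semiring structure on `F(X)`. -/
noncomputable instance (X : FinGSet.{u} G) : CommSemiring (F.obj X) where
  add_assoc := isPushforward_T.map_fold_assoc
  add_comm := isPushforward_T.map_fold_comm
  zero_add := isPushforward_T.map_fold_empty
  add_zero a := (isPushforward_T.map_fold_comm a _).trans (isPushforward_T.map_fold_empty a)
  mul_assoc := isPushforward_N.map_fold_assoc
  mul_comm := isPushforward_N.map_fold_comm
  one_mul := isPushforward_N.map_fold_empty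
  mul_one a := (isPushforward_N.map_fold_comm a _).trans (isPushforward_N.map_fold_empty a)
  left_distrib := SemiTambaraFunctor.mul_add
  right_distrib a b c := by
    have h : ∀ x y : F.obj X, x * y = y * x := isPushforward_N.map_fold_comm
    rw [h, SemiTambaraFunctor.mul_add, h c a, h c b]
  zero_mul a := (isPushforward_N.map_fold_comm _ a).trans (SemiTambaraFunctor.mul_zero a)
  mul_zero := SemiTambaraFunctor.mul_zero
  nsmul := nsmulRec
  npow := npowRec

end SemiTambaraFunctor

/-- Each commutative monoid `(F(X), +)` is an abelian group. -/
def SemiTambaraFunctor.HasAddInverses {G : Type u} [Group G] (F : SemiTambaraFunctor.{u, v} G) :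
    Prop :=
  ∀ (X : FinGSet.{u} G) (a : F.obj X), ∃ b : F.obj X, a + b = 0

/-- A `G`-Tambara functor: a `G`-semi-Tambara functor whose values are abelian groups under
addition. -/
structure TambaraFunctor (G : Type u) [Group G] : Type (max (u + 1) (v + 1))
    extends SemiTambaraFunctor.{u, v} G where
  hasAddInverses : toSemiTambaraFunctor.HasAddInverses

namespace TambaraFunctor

variable {G : Type u} [Group G]

/-- The commutative ring structure on `F(X)`, extending the semiring structure. -/
noncomputable instance (F : TambaraFunctor.{u, v} G) (X : FinGSet.{u} G) : CommRing (F.obj X) :=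
  { (inferInstance : CommSemiring (F.toSemiTambaraFunctor.obj X)) with
    neg := fun a => (F.hasAddInverses X a).choose
    neg_add_cancel := fun a => (add_comm _ a).trans (F.hasAddInverses X a).choose_spec
    zsmul := @zsmulRec _ ⟨0⟩ ⟨(· + ·)⟩ ⟨fun a => (F.hasAddInverses X a).choose⟩ nsmulRec }

/-- A morphism of `G`-Tambara functors: a natural transformation, that is, a family of maps
commuting with all transfers, norms and restrictions. -/
structure Hom (F F' : TambaraFunctor.{u, v} G) where
  app : ∀ X : FinGSet.{u} G, F.obj X → F'.obj X
  app_T : ∀ {X Y : FinGSet.{u} G} (f : X →[G] Y) (a : F.obj X), app Y (F.T f a) = F'.T f (app X a)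
  app_N : ∀ {X Y : FinGSet.{u} G} (f : X →[G] Y) (a : F.obj X), app Y (F.N f a) = F'.N f (app X a)
  app_R : ∀ {X Y : FinGSet.{u} G} (f : X →[G] Y) (a : F.obj Y), app X (F.R f a) = F'.R f (app Y a)

/-- `A`, with the element `x` of `A(G/H)`, is the free `G`-Tambara functor `𝒜[x_H]` on one generator
at level `G/H`: it represents the functor sending a `G`-Tambara functor `K` to the set `K(G/H)`, with
universal element `x`. -/
def IsFree [Finite G] (H : Subgroup G) (A : TambaraFunctor.{u, v} G)
    (x : A.obj (FinGSet.orbit H)) : Prop :=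
  ∀ (K : TambaraFunctor.{u, v} G) (b : K.obj (FinGSet.orbit H)),
    ∃! φ : Hom A K, φ.app (FinGSet.orbit H) x = b

end TambaraFunctor

-- Write x for the generator. The exchange rules bring every composite of transfers, norms and
-- restrictions of x into the form T N R x, a "polynomial" in x; sums and products keep this form.
-- Additive inverses force differences of polynomials, and the only difficulty there is the norm of
-- a difference. The formula `N_add` writes N(a + v) as N(a) plus a transfer of products N(a|U)
-- N(v|Uᶜ) over proper subsets U of the fibres, so induction on the size of the fibres shows that
-- N(a) is again a difference of polynomials (`norm_of_card_le`). Splitting finite G-sets into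
-- orbits, F(Y) is then additively generated by the transfers, along the finitely many maps G/K → Y,
-- of products of elements of a finite set, the norms of restrictions of x between orbits.
--
-- Finite generation follows as for rings of invariants. Restriction along f : X → Y is integral
-- (`isIntegralElem_restriction`): a is a root of the analogue of ∏(T - a_i), whose coefficients are
-- elementary symmetric functions along the fibres of f. Let A be the subring of F(Y) generated by
-- the coefficients of integral equations for the finitely many orbit norms. The A-algebras
-- generated by these norms are finite A-modules, transfers are A-linear by Frobenius reciprocity,
-- and so F(Y) is a finite module over the finitely generated ring A
-- (`Algebra.FiniteType.of_transfers`).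
--
-- The free functor consists of formal expressions modulo equality of their values in all Tambara
-- functors. It first lives in too large a universe; but its values are finitely generated rings,
-- hence countable, hence small, and the structure is transported to small copies. Any other free
-- functor is a retract of this one, so its values are quotients of finitely generated rings.

universe w
-- Pushforwards and disjoint unions, general dependent products, Frobenius reciprocity
namespace SemiTambaraFunctor

open FinGSet

variable {G : Type u} [Group G] {F : SemiTambaraFunctor.{u, v} G} {X Y Z W V E : FinGSet.{u} G}

theorem R_desc (f : X →[G] Z) (g : Y →[G] Z) (a : F.obj Z) :
    F.R (desc f g) a = F.pair (F.R f a) (F.R g a) := by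
  refine sum_ext ?_ ?_ <;> rw [← F.R_comp]
  · exact (R_inl_pair _ _).symm
  · exact (R_inr_pair _ _).symm

theorem R_map_pair (f : X →[G] Z) (g : Y →[G] W) (a : F.obj Z) (b : F.obj W) :
    F.R (desc ((inl Z W).comp f) ((inr Z W).comp g)) (F.pair a b) =
      F.pair (F.R f a) (F.R g b) := by
  rw [R_desc, F.R_comp, F.R_comp, R_inl_pair, R_inr_pair]

namespace IsPushforward

variable {M : ∀ {X Y : FinGSet.{u} G}, (X →[G] Y) → F.obj X → F.obj Y}

theorem map_desc (hM : IsPushforward F M) (f : X →[G] Z) (g : Y →[G] Z) (a : F.obj X)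
    (b : F.obj Y) : M (desc f g) (F.pair a b) = M (fold Z) (F.pair (M f a) (M g b)) := by
  rw [← hM.map_sum, ← hM.map_comp]
  congr 1
  ext (x | y) <;> rfl

theorem map_map_fold (hM : IsPushforward F M) (f : X →[G] Y) (a b : F.obj X) :
    M f (M (fold X) (F.pair a b)) = M (fold Y) (F.pair (M f a) (M f b)) := by
  rw [← hM.map_desc, ← hM.map_comp]
  congr 1
  ext (x | y) <;> rfl

theorem map_map_fromEmpty (hM : IsPushforward F M) (f : X →[G] Y) :
    M f (M (fromEmpty X) F.emptyPt) = M (fromEmpty Y) F.emptyPt := by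
  rw [← hM.map_comp]
  congr 1
  ext x
  exact isEmptyElim x

theorem R_map_fold (hM : IsPushforward F M) (f : X →[G] Y) (a b : F.obj Y) :
    F.R f (M (fold Y) (F.pair a b)) = M (fold X) (F.pair (F.R f a) (F.R f b)) := by
  rw [hM.R_map (fold X) (desc ((inl Y Y).comp f) ((inr Y Y).comp f)) (fold Y) f, R_map_pair]
  refine ⟨by rintro (x | x) <;> rfl, ?_⟩
  rintro (y | y) x (rfl : y = f x)
  · refine ⟨Sum.inl x, ⟨rfl, rfl⟩, ?_⟩
    rintro (z | z) ⟨h, h'⟩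
    · exact congrArg Sum.inl h'
    · exact (Sum.inr_ne_inl h).elim
  · refine ⟨Sum.inr x, ⟨rfl, rfl⟩, ?_⟩
    rintro (z | z) ⟨h, h'⟩
    · exact (Sum.inl_ne_inr h).elim
    · exact congrArg Sum.inr h'

theorem R_map_fromEmpty (hM : IsPushforward F M) (f : X →[G] Y) :
    F.R f (M (fromEmpty Y) F.emptyPt) = M (fromEmpty X) F.emptyPt := by
  rw [hM.R_map (fromEmpty X) (.id G) (fromEmpty Y) f, F.R_id]
  exact ⟨fun x => isEmptyElim x, fun x => isEmptyElim x⟩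

theorem map_of_isEmpty (hM : IsPushforward F M) [hX : IsEmpty X] (f : X →[G] Y) (a : F.obj X) :
    M f a = M (fromEmpty Y) F.emptyPt := by
  rw [← hM.map_R (fromEmpty X) ⟨fun x => isEmptyElim x, fun x => hX.elim x⟩ a, ← hM.map_comp,
    eq_of_empty (F.R _ _) F.emptyPt]
  congr 1
  ext x
  exact isEmptyElim x

/-- Pushforward splits along a decomposition of the source into two pieces. -/
theorem map_split (hM : IsPushforward F M) (i : X →[G] Z) (j : Y →[G] Z)
    (hb : Function.Bijective (desc i j)) (f : Z →[G] W) (a : F.obj Z) :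
    M f a = M (fold W) (F.pair (M (f.comp i) (F.R i a)) (M (f.comp j) (F.R j a))) := by
  conv_lhs => rw [← hM.map_R _ hb a, ← hM.map_comp, R_desc]
  rw [← hM.map_desc]
  congr 1
  ext (x | y) <;> rfl

end IsPushforward

theorem T_add (f : X →[G] Y) (a b : F.obj X) : F.T f (a + b) = F.T f a + F.T f b :=
  isPushforward_T.map_map_fold f a b

theorem T_zero (f : X →[G] Y) : F.T f 0 = 0 := isPushforward_T.map_map_fromEmpty f

theorem R_add (f : X →[G] Y) (a b : F.obj Y) : F.R f (a + b) = F.R f a + F.R f b :=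
  isPushforward_T.R_map_fold f a b

theorem R_zero (f : X →[G] Y) : F.R f (0 : F.obj Y) = 0 := isPushforward_T.R_map_fromEmpty f

theorem R_mul (f : X →[G] Y) (a b : F.obj Y) : F.R f (a * b) = F.R f a * F.R f b :=
  isPushforward_N.R_map_fold f a b

theorem R_one (f : X →[G] Y) : F.R f (1 : F.obj Y) = 1 := isPushforward_N.R_map_fromEmpty f

theorem T_desc (f : X →[G] Z) (g : Y →[G] Z) (a : F.obj X) (b : F.obj Y) :
    F.T (desc f g) (F.pair a b) = F.T f a + F.T g b := isPushforward_T.map_desc f g a b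

theorem N_desc (f : X →[G] Z) (g : Y →[G] Z) (a : F.obj X) (b : F.obj Y) :
    F.N (desc f g) (F.pair a b) = F.N f a * F.N g b := isPushforward_N.map_desc f g a b

theorem T_of_isEmpty [IsEmpty X] (f : X →[G] Y) (a : F.obj X) : F.T f a = 0 :=
  isPushforward_T.map_of_isEmpty f a

theorem N_of_isEmpty [IsEmpty X] (f : X →[G] Y) (a : F.obj X) : F.N f a = 1 :=
  isPushforward_N.map_of_isEmpty f a

/-- An element of `F(X ⨿ Y)` is the sum of the transfers of its two components. -/
theorem pair_eq_add (a : F.obj X) (b : F.obj Y) :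
    F.pair a b = F.T (inl X Y) a + F.T (inr X Y) b := by
  rw [← T_desc, show desc (inl X Y) (inr X Y) = .id G by ext (x | x) <;> rfl, F.T_id]

/-- The rule for a norm of a transfer, for any bispan `X ← E → V → Z` with the universal property
of the dependent product. -/
theorem N_T_of_isDependentProduct (f : X →[G] Y) (g : Y →[G] Z) (p : V →[G] Z) (q : E →[G] V)
    (e : E →[G] X) (hsq : IsPullbackSq q (f.comp e) g p)
    (hinj : ∀ v v', p v = p v' → (∀ x x', q x = v → q x' = v' → f (e x) = f (e x') → e x = e x') →
      v = v')
    (hsurj : ∀ (z : Z) (t : {y : Y // g y = z} → X), (∀ y, f (t y) = y) →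
      ∃ v, p v = z ∧ ∀ x hx, q x = v → e x = t ⟨f (e x), hx⟩) (a : F.obj X) :
    F.N g (F.T f a) = F.T p (F.N q (F.R e a)) := by
  have key : ∀ (v : V) (y : Y), g y = p v → ∃ x, f (e x) = y ∧ q x = v := fun v y h =>
    (hsq.2 y v h).exists
  -- `l v y` is the point of E over (y, v). Thus v determines the section y ↦ e (l v y) of f over
  -- the fibre at p v; this is the comparison map `s : V → Π_g f`, which `hinj` and `hsurj` make
  -- bijective.
  choose l hl hl' using key
  have huniq : ∀ x x', f (e x) = f (e x') → q x = q x' → x = x' := fun x x' h h' =>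
    (hsq.2 (f (e x)) (q x) (hsq.1 x)).unique ⟨rfl, rfl⟩ ⟨h.symm, h'.symm⟩
  let s : V →[G] piSet f g :=
    { toFun := fun v => ⟨p v, fun y => e (l v y.1 y.2), fun y => hl v y.1 y.2⟩
      map_smul' := fun γ v => by
        refine PiCarrier.ext' (map_smul p γ v) fun y hp hq => ?_
        change e (l (γ • v) y _) = γ • e (l v (γ⁻¹ • y) _)
        rw [← map_smul]
        congr 1
        refine huniq _ _ ?_ ?_
        · rw [hl, map_smul, map_smul, hl, smul_inv_smul]
        · rw [hl', map_smul, hl'] }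
  have hs : Function.Bijective s := by
    constructor
    · intro v v' h
      refine hinj v v' (congrArg Sigma.fst h) fun x x' hx hx' hxx => ?_
      have hpv : p v = p v' := congrArg Sigma.fst h
      have e1 : g (f (e x)) = p v := by rw [← hx]; exact hsq.1 x
      have e2 : g (f (e x)) = p v' := e1.trans hpv
      have h1 : x = l v (f (e x)) e1 := huniq _ _ (hl _ _ _).symm (by rw [hl', hx])
      have h2 : x' = l v' (f (e x)) e2 := huniq _ _ (by rw [hl, hxx]) (by rw [hl', hx'])
      have h3 : ∀ (r : piSet f g), s v = r → ∀ hr : g (f (e x)) = r.1,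
          e (l v (f (e x)) e1) = r.2.1 ⟨f (e x), hr⟩ := by
        rintro _ rfl hr
        rfl
      rw [h1, h2]
      exact h3 _ h e2
    · rintro ⟨z, t, ht⟩
      obtain ⟨v, hv, hvx⟩ := hsurj z t ht
      refine ⟨v, PiCarrier.ext' hv fun y hp hq => ?_⟩
      change e (l v y _) = t ⟨y, hq⟩
      rw [hvx (l v y hp) (by rw [hl]; exact hq) (hl' _ _ _)]
      congr 2
      exact hl _ _ _
  let k : E →[G] piPullback f g :=
    { toFun := fun x => ⟨(f (e x), s (q x)), hsq.1 x⟩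
      map_smul' := fun γ x => Subtype.ext (Prod.ext
        (by change f (e (γ • x)) = γ • f (e x); simp)
        (by change s (q (γ • x)) = γ • s (q x); simp)) }
  rw [F.N_T, show p = (piMap f g).comp s from rfl, F.T_comp]
  congr 1
  rw [← isPushforward_T.map_R s hs (F.N (piPullbackSnd f g) (F.R (piCounit f g) a)),
    F.R_N q k (piPullbackSnd f g) s, ← F.R_comp]
  · congr 3
    ext x
    change e (l (q x) (f (e x)) _) = e x
    congr 1
    exact huniq _ _ (hl _ _ _) (hl' _ _ _)
  · refine ⟨fun x => rfl, ?_⟩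
    rintro ⟨⟨y, r⟩, hr⟩ v (rfl : r = s v)
    refine ⟨l v y hr, ⟨Subtype.ext (Prod.ext (hl _ _ _) (congrArg s (hl' _ _ _))), hl' _ _ _⟩, ?_⟩
    rintro x ⟨h, rfl⟩
    exact huniq _ _ ((congrArg (fun r => r.1.1) h).trans (hl _ _ _).symm) (hl' _ _ _).symm

/-- Frobenius reciprocity. -/
theorem T_R_mul (f : X →[G] Y) (a : F.obj Y) (b : F.obj X) :
    F.T f (F.R f a * b) = a * F.T f b := by
  have h1 := isPushforward_T.map_sum (.id G) f a b
  rw [F.T_id] at h1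
  -- The product is the norm along the fold map of the transfer of (a, b) along id ⨿ f. A section of
  -- id ⨿ f over the two points of the fibre at z is just a point of X over z, so the dependent
  -- product is X, with pullback X ⨿ X.
  rw [mul_def a, ← h1, N_T_of_isDependentProduct _ _ f (fold X)
    (desc ((inl Y X).comp f) ((inr Y X).comp (.id G))), R_map_pair, F.R_id, mul_def]
  · refine ⟨by rintro (x | x) <;> rfl, ?_⟩
    rintro (y | y) x (rfl : y = f x)
    · refine ⟨Sum.inl x, ⟨rfl, rfl⟩, ?_⟩
      rintro (z | z) ⟨h, h'⟩
      · exact congrArg Sum.inl h'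
      · exact (Sum.inr_ne_inl h).elim
    · refine ⟨Sum.inr x, ⟨rfl, rfl⟩, ?_⟩
      rintro (z | z) ⟨h, h'⟩
      · exact (Sum.inl_ne_inr h).elim
      · exact congrArg Sum.inr h'
  · intro v v' h h'
    exact Sum.inr_injective (h' (Sum.inr v) (Sum.inr v') rfl rfl (congrArg Sum.inr h))
  · intro z t ht
    have h1 := ht ⟨Sum.inl z, rfl⟩
    have h2 := ht ⟨Sum.inr z, rfl⟩
    rcases hx1 : t ⟨Sum.inl z, rfl⟩ with y | x'
    swap
    · rw [hx1] at h1
      exact (Sum.inr_ne_inl h1).elim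
    rcases hx : t ⟨Sum.inr z, rfl⟩ with y' | x
    · rw [hx] at h2
      exact (Sum.inl_ne_inr h2).elim
    rw [hx] at h2
    rw [hx1] at h1
    obtain rfl : f x = z := Sum.inr_injective h2
    obtain rfl : y = f x := Sum.inl_injective h1
    refine ⟨x, rfl, ?_⟩
    rintro (w | w) hw (rfl : w = x)
    · exact hx1.symm
    · exact hx.symm

end SemiTambaraFunctor

/-! ### Pullbacks and decomposition into orbits -/

namespace FinGSet

variable {G : Type u} [Group G]

/-- The finite `G`-set underlying an invariant subset. -/
abbrev ofSub (X : FinGSet.{u} G) (s : SubMulAction G X) : FinGSet.{u} G := ⟨s⟩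

/-- The pullback of two equivariant maps, as an invariant subset of the product. -/
def pullbackSub {X Y Z : FinGSet.{u} G} (f : X →[G] Z) (g : Y →[G] Z) :
    SubMulAction G (X × Y) where
  carrier := {p | f p.1 = g p.2}
  smul_mem' γ p (h : f p.1 = g p.2) := by
    change f (γ • p.1) = g (γ • p.2)
    rw [map_smul, map_smul, h]

/-- The pullback of two equivariant maps. -/
abbrev pullback {X Y Z : FinGSet.{u} G} (f : X →[G] Z) (g : Y →[G] Z) : FinGSet.{u} G :=
  ⟨pullbackSub f g⟩

/-- The first projection from the pullback. -/
def pullbackFst {X Y Z : FinGSet.{u} G} (f : X →[G] Z) (g : Y →[G] Z) : pullback f g →[G] X where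
  toFun p := p.1.1
  map_smul' _ _ := rfl

/-- The second projection from the pullback. -/
def pullbackSnd {X Y Z : FinGSet.{u} G} (f : X →[G] Z) (g : Y →[G] Z) : pullback f g →[G] Y where
  toFun p := p.1.2
  map_smul' _ _ := rfl

theorem isPullbackSq_pullback {X Y Z : FinGSet.{u} G} (f : X →[G] Z) (g : Y →[G] Z) :
    IsPullbackSq (pullbackSnd f g) (pullbackFst f g) f g :=
  ⟨fun w => w.2, fun x y h => ⟨⟨(x, y), h⟩, ⟨rfl, rfl⟩, fun _ hw =>
    Subtype.ext (Prod.ext hw.1 hw.2)⟩⟩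

instance {X Y : FinGSet.{u} G} : Finite (X →[G] Y) := DFunLike.finite _

/-- The map `G/K → X` determined by a point with stabilizer `K`. -/
def ofStabilizer [Finite G] {X : FinGSet.{u} G} (x : X) :
    orbit (MulAction.stabilizer G x) →[G] X where
  toFun := MulAction.ofQuotientStabilizer G x
  map_smul' γ y := MulAction.ofQuotientStabilizer_smul G x γ y

/-- The complement of the orbit of a point. -/
def orbitCompl {X : FinGSet.{u} G} (x : X) : SubMulAction G X where
  carrier := (MulAction.orbit G x)ᶜ
  smul_mem' γ y hy h := hy (by
    rw [← inv_smul_smul γ y]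
    exact MulAction.mem_orbit_of_mem_orbit _ h)

theorem bijective_desc_ofStabilizer [Finite G] {X : FinGSet.{u} G} (x : X) :
    Function.Bijective
      (desc (Y := X.ofSub (orbitCompl x)) (ofStabilizer x) (orbitCompl x).subtype) := by
  have hmem : ∀ y, ofStabilizer x y ∈ MulAction.orbit G x := fun y =>
    MulAction.ofQuotientStabilizer_mem_orbit G x y
  constructor
  · rintro (y | y) (z | z) h
    · exact congrArg Sum.inl (MulAction.injective_ofQuotientStabilizer G x h)
    · exact (z.2 (by rw [← show ofStabilizer x y = z.1 from h]; exact hmem y)).elim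
    · exact (y.2 (by rw [show y.1 = ofStabilizer x z from h]; exact hmem z)).elim
    · exact congrArg Sum.inr (Subtype.ext h)
  · intro y
    by_cases hy : y ∈ MulAction.orbit G x
    · obtain ⟨γ, rfl⟩ := hy
      exact ⟨Sum.inl (γ : G ⧸ MulAction.stabilizer G x), rfl⟩
    · exact ⟨Sum.inr ⟨y, hy⟩, rfl⟩

end FinGSet

namespace SemiTambaraFunctor

open FinGSet

variable {G : Type u} [Group G] {F : SemiTambaraFunctor.{u, v} G} {X Y Z : FinGSet.{u} G}

/-- Frobenius reciprocity for f, base change along the pullback square, then Frobenius reciprocity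
for the projection. This makes polynomials closed under products. -/
theorem T_mul_T (f : X →[G] Z) (g : Y →[G] Z) (a : F.obj X) (b : F.obj Y) :
    F.T f a * F.T g b = F.T (f.comp (pullbackSnd g f))
      (F.R (pullbackSnd g f) a * F.R (pullbackFst g f) b) := by
  rw [F.T_comp, T_R_mul, ← F.R_T _ _ _ _ (isPullbackSq_pullback g f), mul_comm a, T_R_mul,
    mul_comm]

/-- If a set of elements of `F(Y)` contains the unit, is closed under the operation of a class of
pushforwards `M`, and contains the pushforwards of the restrictions of `a` to orbits, then it
contains the pushforward of `a`. -/
theorem IsPushforward.map_mem_of_orbits [Finite G]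
    {M : ∀ {X Y : FinGSet.{u} G}, (X →[G] Y) → F.obj X → F.obj Y} (hM : IsPushforward F M)
    (S : Set (F.obj Y)) (h0 : M (fromEmpty Y) F.emptyPt ∈ S)
    (hadd : ∀ a ∈ S, ∀ b ∈ S, M (fold Y) (F.pair a b) ∈ S) (f : X →[G] Y) (a : F.obj X)
    (ho : ∀ (K : Subgroup G) (o : orbit K →[G] X), M (f.comp o) (F.R o a) ∈ S) : M f a ∈ S := by
  induction h : Nat.card X using Nat.strong_induction_on generalizing X with
  | _ n ih =>
    subst h
    rcases isEmpty_or_nonempty X with hX | ⟨⟨x⟩⟩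
    · rwa [hM.map_of_isEmpty]
    -- Split off the orbit of x; its complement misses x and has fewer points.
    rw [hM.map_split _ _ (bijective_desc_ofStabilizer x) f a]
    refine hadd _ (ho _ _) _ (ih _ ?_ _ _ (fun K o => ?_) rfl)
    · exact Finite.card_subtype_lt (p := fun y => y ∈ orbitCompl x) (x := x)
        fun h => h (MulAction.mem_orbit_self x)
    · rw [← F.R_comp]
      exact ho K ((SubMulAction.subtype _).comp o)

end SemiTambaraFunctor

/-! ### Proper subsets of fibres and the norm of a sum -/

namespace FinGSet

open scoped Pointwise

variable {G : Type u} [Group G] {W Z : FinGSet.{u} G} (g : W →[G] Z)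

/-- The subset `U` is properly contained in the fibre of `g` at `z`. -/
def IsProperPart (z : Z) (U : Set W) : Prop :=
  (∀ w ∈ U, g w = z) ∧ ∃ w, g w = z ∧ w ∉ U

variable {g}

theorem IsProperPart.smul (γ : G) {z : Z} {U : Set W} (h : IsProperPart g z U) :
    IsProperPart g (γ • z) (γ • U) := by
  obtain ⟨h1, w, hw, hwU⟩ := h
  refine ⟨?_, γ • w, by rw [map_smul, hw], by rwa [Set.smul_mem_smul_set_iff]⟩
  rintro _ ⟨w, hw, rfl⟩
  change g (γ • w) = _
  rw [map_smul, h1 w hw]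

variable (g)

/-- The `G`-set of pairs `(z, U)` of a point of `Z` and a proper subset of the fibre of `g` at
`z`. -/
def properParts : SubMulAction G (Z × Set W) where
  carrier := {p | IsProperPart g p.1 p.2}
  smul_mem' γ _ h := IsProperPart.smul γ h

/-- The `G`-set of pairs `(w, U)` of a proper subset `U` of a fibre of `g` and `w ∈ U`. -/
def properPartsIn : SubMulAction G (W × Set W) where
  carrier := {p | p.1 ∈ p.2 ∧ IsProperPart g (g p.1) p.2}
  smul_mem' γ p h := ⟨Set.smul_mem_smul_set_iff.2 h.1, by
    have := h.2.smul γ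
    rwa [← map_smul] at this⟩

/-- The `G`-set of pairs `(w, U)` of a proper subset `U` of a fibre of `g` and a point `w` of this
fibre that is not in `U`. -/
def properPartsOut : SubMulAction G (W × Set W) where
  carrier := {p | p.1 ∉ p.2 ∧ IsProperPart g (g p.1) p.2}
  smul_mem' γ p h := ⟨fun h' => h.1 (Set.smul_mem_smul_set_iff.1 h'), by
    have := h.2.smul γ
    rwa [← map_smul] at this⟩

/-- The projection `(z, U) ↦ z`. -/
def properPartsMap : ofSub ⟨Z × Set W⟩ (properParts g) →[G] Z where
  toFun p := p.1.1
  map_smul' _ _ := rfl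

/-- The projection `(w, U) ↦ (g w, U)`. -/
def properPartsInSnd :
    ofSub ⟨W × Set W⟩ (properPartsIn g) →[G] ofSub ⟨Z × Set W⟩ (properParts g) where
  toFun p := ⟨(g p.1.1, p.1.2), p.2.2⟩
  map_smul' γ p := Subtype.ext (Prod.ext (map_smul g γ p.1.1) rfl)

/-- The projection `(w, U) ↦ w`. -/
def properPartsInFst : ofSub ⟨W × Set W⟩ (properPartsIn g) →[G] W where
  toFun p := p.1.1
  map_smul' _ _ := rfl

/-- The projection `(w, U) ↦ (g w, U)`. -/
def properPartsOutSnd :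
    ofSub ⟨W × Set W⟩ (properPartsOut g) →[G] ofSub ⟨Z × Set W⟩ (properParts g) where
  toFun p := ⟨(g p.1.1, p.1.2), p.2.2⟩
  map_smul' γ p := Subtype.ext (Prod.ext (map_smul g γ p.1.1) rfl)

/-- The projection `(w, U) ↦ w`. -/
def properPartsOutFst : ofSub ⟨W × Set W⟩ (properPartsOut g) →[G] W where
  toFun p := p.1.1
  map_smul' _ _ := rfl

/-- The fibre over (z, U) is U, a proper subset of the fibre of g at z. This strict drop drives the
induction for norms of differences. -/
theorem card_fiber_properPartsInSnd_lt (p : ofSub ⟨Z × Set W⟩ (properParts g)) :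
    Nat.card {e // properPartsInSnd g e = p} < Nat.card {w // g w = properPartsMap g p} := by
  obtain ⟨⟨z, U⟩, hU, w, hw, hwU⟩ := p
  have : Nat.card {x : {w // g w = z} // x.1 ∈ U} < Nat.card {w // g w = z} :=
    Finite.card_subtype_lt (x := ⟨w, hw⟩) hwU
  have hmem : ∀ e : ofSub ⟨W × Set W⟩ (properPartsIn g),
      properPartsInSnd g e = ⟨(z, U), hU, w, hw, hwU⟩ → e.1.1 ∈ U := by
    rintro ⟨⟨w', U'⟩, h1, h2⟩ h
    obtain rfl : U' = U := congrArg (fun p => p.1.2) h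
    exact h1
  refine lt_of_le_of_lt (Nat.card_le_card_of_injective
    (fun e => ⟨⟨e.1.1.1, congrArg (fun p => p.1.1) e.2⟩, hmem e.1 e.2⟩) ?_) this
  rintro ⟨⟨⟨w1, U1⟩, h1⟩, e1⟩ ⟨⟨⟨w2, U2⟩, h2⟩, e2⟩ h
  obtain rfl : U1 = U := congrArg (fun p => p.1.2) e1
  obtain rfl : U2 = U1 := congrArg (fun p => p.1.2) e2
  obtain rfl : w1 = w2 := congrArg (fun x => x.1.1) h
  rfl

end FinGSet

namespace SemiTambaraFunctor

open FinGSet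
open scoped Pointwise

variable {G : Type u} [Group G] {F : SemiTambaraFunctor.{u, v} G} {W X Y Z : FinGSet.{u} G}

/-- The norm of a sum. -/
theorem N_add (g : W →[G] Z) (a b : F.obj W) :
    F.N g (a + b) = F.N g a + F.T (properPartsMap g)
      (F.N (properPartsInSnd g) (F.R (properPartsInFst g) a) *
        F.N (properPartsOutSnd g) (F.R (properPartsOutFst g) b)) := by
  classical
  -- A section of the fold map over the fibre at z is the subset U on which it selects the first
  -- copy of W. The case where U is the whole fibre is kept as a separate summand Z and yields N(a);
  -- the remaining U are the proper subsets.
  rw [add_def, N_T_of_isDependentProduct (fold W) g (desc (.id G) (properPartsMap g))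
    (desc (X := W) ((inl _ _).comp g)
      ((inr _ _).comp (desc (properPartsInSnd g) (properPartsOutSnd g))))
    (desc (inl W W) (desc ((inl W W).comp (properPartsInFst g))
      ((inr W W).comp (properPartsOutFst g))))]
  · rw [R_desc, R_desc, F.R_comp, F.R_comp, R_inl_pair, R_inr_pair, isPushforward_N.map_sum,
      T_desc, F.T_id, N_desc]
  · constructor
    · rintro (w | w | w) <;> rfl
    · rintro w (z | ⟨⟨z, U⟩, hU⟩) (rfl : g w = z)
      · refine ⟨Sum.inl w, ⟨rfl, rfl⟩, ?_⟩
        rintro (w' | w' | w') ⟨h, h'⟩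
        · exact congrArg Sum.inl h
        · exact (Sum.inr_ne_inl h').elim
        · exact (Sum.inr_ne_inl h').elim
      · by_cases hw : w ∈ U
        · refine ⟨Sum.inr (Sum.inl ⟨(w, U), hw, hU⟩), ⟨rfl, rfl⟩, ?_⟩
          rintro (w' | ⟨⟨w', U'⟩, h1, h2⟩ | ⟨⟨w', U'⟩, h1, h2⟩) ⟨h, h'⟩
          · exact (Sum.inl_ne_inr h').elim
          · obtain rfl : w' = w := h
            obtain rfl : U' = U := congrArg (fun p => p.1.2) (Sum.inr_injective h')
            rfl
          · obtain rfl : w' = w := h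
            obtain rfl : U' = U := congrArg (fun p => p.1.2) (Sum.inr_injective h')
            exact (h1 hw).elim
        · refine ⟨Sum.inr (Sum.inr ⟨(w, U), hw, hU⟩), ⟨rfl, rfl⟩, ?_⟩
          rintro (w' | ⟨⟨w', U'⟩, h1, h2⟩ | ⟨⟨w', U'⟩, h1, h2⟩) ⟨h, h'⟩
          · exact (Sum.inl_ne_inr h').elim
          · obtain rfl : w' = w := h
            obtain rfl : U' = U := congrArg (fun p => p.1.2) (Sum.inr_injective h')
            exact (hw h1).elim
          · obtain rfl : w' = w := h
            obtain rfl : U' = U := congrArg (fun p => p.1.2) (Sum.inr_injective h')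
            rfl
  -- At a point of U outside V the two sections would select different copies of W; so equal
  -- sections force U ⊆ V, and the reverse inclusion by symmetry.
  · have aux : ∀ (z : Z) (U V : Set W) (hU : IsProperPart g z U) (hV : IsProperPart g z V),
        (∀ x x', desc (X := W) ((inl Z (ofSub ⟨Z × Set W⟩ (properParts g))).comp g)
          ((inr _ _).comp (desc (properPartsInSnd g) (properPartsOutSnd g))) x =
            inr Z (ofSub ⟨Z × Set W⟩ (properParts g)) ⟨(z, U), hU⟩ →
          desc (X := W) ((inl Z (ofSub ⟨Z × Set W⟩ (properParts g))).comp g)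
          ((inr _ _).comp (desc (properPartsInSnd g) (properPartsOutSnd g))) x' =
            inr Z (ofSub ⟨Z × Set W⟩ (properParts g)) ⟨(z, V), hV⟩ →
          fold W (desc (inl W W) (desc ((inl W W).comp (properPartsInFst g))
            ((inr W W).comp (properPartsOutFst g))) x) =
          fold W (desc (inl W W) (desc ((inl W W).comp (properPartsInFst g))
            ((inr W W).comp (properPartsOutFst g))) x') →
          desc (inl W W) (desc ((inl W W).comp (properPartsInFst g))
            ((inr W W).comp (properPartsOutFst g))) x =
          desc (inl W W) (desc ((inl W W).comp (properPartsInFst g))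
            ((inr W W).comp (properPartsOutFst g))) x') → U ⊆ V := by
      intro z U V hU hV h w hw
      by_contra hwV
      obtain rfl := hU.1 w hw
      exact Sum.inl_ne_inr (h (Sum.inr (Sum.inl ⟨(w, U), hw, hU⟩))
        (Sum.inr (Sum.inr ⟨(w, V), hwV, hV⟩)) rfl rfl rfl)
    rintro (z | ⟨⟨z, U⟩, hU⟩) (z' | ⟨⟨z', V⟩, hV⟩) hz h
    · exact congrArg Sum.inl hz
    · obtain ⟨w, hw, hwV⟩ := hV.2
      obtain rfl : z = z' := hz
      obtain rfl : g w = z := hw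
      exact (Sum.inl_ne_inr (h (Sum.inl w) (Sum.inr (Sum.inr ⟨(w, V), hwV, hV⟩)) rfl rfl rfl)).elim
    · obtain ⟨w, hw, hwU⟩ := hU.2
      obtain rfl : z = z' := hz
      obtain rfl : g w = z := hw
      exact (Sum.inr_ne_inl (h (Sum.inr (Sum.inr ⟨(w, U), hwU, hU⟩)) (Sum.inl w) rfl rfl rfl)).elim
    · obtain rfl : z = z' := hz
      have h1 := aux z U V hU hV h
      have h2 := aux z V U hV hU fun x x' hx hx' hxx => (h x' x hx' hx hxx.symm).symm
      obtain rfl : U = V := Set.Subset.antisymm h1 h2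
      rfl
  · intro z t ht
    have htl : ∀ y, t y = Sum.inl y.1 ∨ t y = Sum.inr y.1 := by
      intro y
      have := ht y
      rcases h : t y with w | w <;> rw [h] at this
      · exact Or.inl (congrArg Sum.inl this)
      · exact Or.inr (congrArg Sum.inr this)
    by_cases hall : ∀ y, t y = Sum.inl y.1
    · refine ⟨Sum.inl z, rfl, ?_⟩
      rintro (w | w | w) hw hx
      · exact (hall ⟨w, hw⟩).symm
      · exact (Sum.inr_ne_inl hx).elim
      · exact (Sum.inr_ne_inl hx).elim
    · push Not at hall
      obtain ⟨⟨w0, hw0⟩, hne⟩ := hall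
      have hU : IsProperPart g z {w | ∃ h : g w = z, t ⟨w, h⟩ = Sum.inl w} :=
        ⟨fun w h => h.1, w0, hw0, fun h => hne h.2⟩
      refine ⟨Sum.inr ⟨(z, _), hU⟩, rfl, ?_⟩
      rintro (w | ⟨⟨w, V⟩, hwV, hV⟩ | ⟨⟨w, V⟩, hwV, hV⟩) hw hx
      · exact (Sum.inl_ne_inr hx).elim
      · obtain rfl : V = _ := congrArg (fun p => p.1.2) (Sum.inr_injective hx)
        exact hwV.2.symm
      · obtain rfl : V = _ := congrArg (fun p => p.1.2) (Sum.inr_injective hx)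
        exact ((htl ⟨w, hw⟩).resolve_left fun h => hwV ⟨hw, h⟩).symm

end SemiTambaraFunctor

/-! ### Polynomials in one element and their differences -/

namespace SemiTambaraFunctor

open FinGSet

variable {G : Type u} [Group G] {F : SemiTambaraFunctor.{u, v} G} {A X Y Z : FinGSet.{u} G}

/-- `m` is a norm of a restriction of `x`. -/
def IsMonomial (x : F.obj A) (m : F.obj X) : Prop :=
  ∃ (E : FinGSet.{u} G) (g : E →[G] X) (h : E →[G] A), m = F.N g (F.R h x)

/-- `a` is a transfer of a norm of a restriction of `x`. -/
def IsPolynomial (x : F.obj A) (a : F.obj X) : Prop :=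
  ∃ (B : FinGSet.{u} G) (f : B →[G] X) (m : F.obj B), IsMonomial x m ∧ a = F.T f m

/-- `a` is a formal difference of two transfers of norms of restrictions of `x`. -/
def IsPolynomialDiff (x : F.obj A) (a : F.obj X) : Prop :=
  ∃ u v : F.obj X, IsPolynomial x u ∧ IsPolynomial x v ∧ a + v = u

variable {x : F.obj A}

namespace IsMonomial

theorem self : IsMonomial x x := ⟨A, .id G, .id G, by rw [F.R_id, F.N_id]⟩

theorem one : IsMonomial x (1 : F.obj X) :=
  ⟨empty G, fromEmpty X, fromEmpty A, (N_of_isEmpty _ _).symm⟩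

theorem mul {m m' : F.obj X} (h : IsMonomial x m) (h' : IsMonomial x m') :
    IsMonomial x (m * m') := by
  obtain ⟨E, g, k, rfl⟩ := h
  obtain ⟨E', g', k', rfl⟩ := h'
  exact ⟨E.sum E', desc g g', desc k k', by rw [R_desc, N_desc]⟩

theorem norm (f : X →[G] Y) {m : F.obj X} (h : IsMonomial x m) : IsMonomial x (F.N f m) := by
  obtain ⟨E, g, k, rfl⟩ := h
  exact ⟨E, f.comp g, k, (F.N_comp _ _ _).symm⟩

theorem restrict (f : X →[G] Y) {m : F.obj Y} (h : IsMonomial x m) : IsMonomial x (F.R f m) := by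
  obtain ⟨E, g, k, rfl⟩ := h
  exact ⟨pullback g f, pullbackSnd g f, k.comp (pullbackFst g f), by
    rw [F.R_N _ _ _ _ (isPullbackSq_pullback g f), F.R_comp]⟩

theorem pair {m : F.obj X} {m' : F.obj Y} (h : IsMonomial x m) (h' : IsMonomial x m') :
    IsMonomial x (F.pair m m') := by
  obtain ⟨E, g, k, rfl⟩ := h
  obtain ⟨E', g', k', rfl⟩ := h'
  exact ⟨E.sum E', _, desc k k', by rw [R_desc]; exact (isPushforward_N.map_sum g g' _ _).symm⟩

theorem isPolynomial {m : F.obj X} (h : IsMonomial x m) : IsPolynomial x m :=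
  ⟨X, .id G, m, h, (F.T_id m).symm⟩

end IsMonomial

namespace IsPolynomial

theorem zero : IsPolynomial x (0 : F.obj X) :=
  ⟨empty G, fromEmpty X, 1, .one, (T_of_isEmpty _ _).symm⟩

theorem add {a b : F.obj X} (h : IsPolynomial x a) (h' : IsPolynomial x b) :
    IsPolynomial x (a + b) := by
  obtain ⟨B, f, m, hm, rfl⟩ := h
  obtain ⟨B', f', m', hm', rfl⟩ := h'
  exact ⟨B.sum B', desc f f', F.pair m m', hm.pair hm', (T_desc _ _ _ _).symm⟩

theorem mul {a b : F.obj X} (h : IsPolynomial x a) (h' : IsPolynomial x b) :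
    IsPolynomial x (a * b) := by
  obtain ⟨B, f, m, hm, rfl⟩ := h
  obtain ⟨B', f', m', hm', rfl⟩ := h'
  exact ⟨_, _, _, (hm.restrict _).mul (hm'.restrict _), T_mul_T f f' m m'⟩

theorem transfer (f : X →[G] Y) {a : F.obj X} (h : IsPolynomial x a) :
    IsPolynomial x (F.T f a) := by
  obtain ⟨B, k, m, hm, rfl⟩ := h
  exact ⟨B, f.comp k, m, hm, (F.T_comp _ _ _).symm⟩

theorem restrict (f : X →[G] Y) {a : F.obj Y} (h : IsPolynomial x a) :
    IsPolynomial x (F.R f a) := by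
  obtain ⟨B, k, m, hm, rfl⟩ := h
  exact ⟨pullback k f, pullbackSnd k f, _, hm.restrict (pullbackFst k f),
    F.R_T _ _ _ _ (isPullbackSq_pullback k f) m⟩

theorem norm (f : X →[G] Y) {a : F.obj X} (h : IsPolynomial x a) : IsPolynomial x (F.N f a) := by
  obtain ⟨B, k, m, hm, rfl⟩ := h
  exact ⟨_, _, _, (hm.restrict _).norm _, F.N_T k f m⟩

end IsPolynomial

namespace IsPolynomialDiff

theorem of_isPolynomial {a : F.obj X} (h : IsPolynomial x a) : IsPolynomialDiff x a :=
  ⟨a, 0, h, .zero, add_zero a⟩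

theorem add {a b : F.obj X} (h : IsPolynomialDiff x a) (h' : IsPolynomialDiff x b) :
    IsPolynomialDiff x (a + b) := by
  obtain ⟨u, v, hu, hv, rfl⟩ := h
  obtain ⟨u', v', hu', hv', rfl⟩ := h'
  exact ⟨_, _, hu.add hu', hv.add hv', by ring⟩

theorem of_add_eq_zero {a b : F.obj X} (hab : a + b = 0) (h : IsPolynomialDiff x a) :
    IsPolynomialDiff x b := by
  obtain ⟨u, v, hu, hv, rfl⟩ := h
  exact ⟨v, _, hv, hu, by rw [← add_assoc, add_comm b, hab, zero_add]⟩

theorem mul {a b : F.obj X} (h : IsPolynomialDiff x a) (h' : IsPolynomialDiff x b) :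
    IsPolynomialDiff x (a * b) := by
  obtain ⟨u, v, hu, hv, rfl⟩ := h
  obtain ⟨u', v', hu', hv', rfl⟩ := h'
  exact ⟨_, _, (hu.mul hu').add (hv.mul hv'), (hu.mul hv').add (hv.mul hu'), by ring⟩

theorem transfer (f : X →[G] Y) {a : F.obj X} (h : IsPolynomialDiff x a) :
    IsPolynomialDiff x (F.T f a) := by
  obtain ⟨u, v, hu, hv, rfl⟩ := h
  exact ⟨_, _, hu.transfer f, hv.transfer f, (T_add f a v).symm⟩

theorem restrict (f : X →[G] Y) {a : F.obj Y} (h : IsPolynomialDiff x a) :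
    IsPolynomialDiff x (F.R f a) := by
  obtain ⟨u, v, hu, hv, rfl⟩ := h
  exact ⟨_, _, hu.restrict f, hv.restrict f, (R_add f a v).symm⟩

/-- Induction on a bound for the fibres, over all maps at once because the inductive step replaces f
by the projection from pairs (w, U) with w ∈ U. In the correction term of `N_add` the difference a
is normed only along this projection, whose fibres are smaller, while the polynomial v can be normed
directly. -/
theorem norm_of_card_le (n : ℕ) : ∀ {X Y : FinGSet.{u} G} (f : X →[G] Y),
    (∀ y, Nat.card {x // f x = y} ≤ n) → ∀ {a : F.obj X}, IsPolynomialDiff x a →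
      IsPolynomialDiff x (F.N f a) := by
  induction n with
  | zero =>
    intro X Y f hf a _
    have : IsEmpty X := ⟨fun b => by
      have := Finite.card_eq_zero_iff.1 (Nat.le_zero.1 (hf (f b)))
      exact this.elim ⟨b, rfl⟩⟩
    rw [N_of_isEmpty]
    exact .of_isPolynomial IsMonomial.one.isPolynomial
  | succ n ih =>
    intro X Y f hf a ha
    obtain ⟨u, v, hu, hv, rfl⟩ := id ha
    obtain ⟨u', v', hu', hv', h⟩ := ((ih (properPartsInSnd f)
      (fun p => Nat.le_of_lt_succ ((card_fiber_properPartsInSnd_lt f p).trans_le (hf _)))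
      (ha.restrict (properPartsInFst f))).mul (of_isPolynomial
        ((hv.restrict (properPartsOutFst f)).norm (properPartsOutSnd f)))).transfer
          (properPartsMap f)
    -- With correction term c = u' - v' one has N(a + v) = N(a) + c, hence N(a) + u' = N(a + v) +
    -- v'.
    refine ⟨_, _, (hu.norm f).add hv', hu', ?_⟩
    rw [N_add, ← h]
    ring

theorem norm (f : X →[G] Y) {a : F.obj X} (h : IsPolynomialDiff x a) :
    IsPolynomialDiff x (F.N f a) :=
  norm_of_card_le (Nat.card X) f (fun _ => Finite.card_subtype_le _) h

theorem pair {a : F.obj X} {b : F.obj Y} (h : IsPolynomialDiff x a) (h' : IsPolynomialDiff x b) :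
    IsPolynomialDiff x (F.pair a b) := by
  rw [pair_eq_add]
  exact (h.transfer _).add (h'.transfer _)

end IsPolynomialDiff

/-- The norms of restrictions of `x` along maps from orbits to an orbit. -/
def orbitNorms [Finite G] (x : F.obj A) (K : Subgroup G) : Set (F.obj (orbit K)) :=
  Set.range fun t : Σ J : Subgroup G, (orbit J →[G] orbit K) × (orbit J →[G] A) =>
    F.N t.2.1 (F.R t.2.2 x)

theorem finite_orbitNorms [Finite G] (x : F.obj A) (K : Subgroup G) : (orbitNorms x K).Finite := by
  have (J : Subgroup G) : Finite ((orbit J →[G] orbit K) × (orbit J →[G] A)) :=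
    have : Finite (orbit J →[G] orbit K) := DFunLike.finite _
    have : Finite (orbit J →[G] A) := DFunLike.finite _
    inferInstance
  exact Set.finite_range _

/-- Splitting the source of the norm into orbits turns the norm into a product, one factor for each
orbit. -/
theorem IsMonomial.mem_closure [Finite G] {K : Subgroup G} {m : F.obj (orbit K)}
    (h : IsMonomial x m) : m ∈ Submonoid.closure (orbitNorms x K) := by
  obtain ⟨E, g, k, rfl⟩ := h
  refine (isPushforward_N (F := F)).map_mem_of_orbits (Submonoid.closure (orbitNorms x K) : Set _)
    ?_ (fun a ha b hb => ?_) g _ fun J o => ?_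
  · exact (Submonoid.closure (orbitNorms x K)).one_mem
  · exact (Submonoid.closure (orbitNorms x K)).mul_mem ha hb
  rw [← F.R_comp]
  exact Submonoid.subset_closure ⟨⟨J, g.comp o, k.comp o⟩, rfl⟩

/-- A transfer of a norm of a restriction of `x` is a sum of transfers, along maps from orbits, of
products of norms of restrictions of `x` along maps between orbits. -/
theorem IsPolynomial.mem_of_orbits [Finite G] {a : F.obj Y} (h : IsPolynomial x a)
    (S : AddSubmonoid (F.obj Y)) (hS : ∀ (K : Subgroup G) (f : orbit K →[G] Y),
      ∀ m ∈ Submonoid.closure (orbitNorms x K), F.T f m ∈ S) : a ∈ S := by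
  obtain ⟨B, f, m, hm, rfl⟩ := h
  refine (isPushforward_T (F := F)).map_mem_of_orbits (S : Set (F.obj Y)) S.zero_mem
    (fun a ha b hb => ?_) f _ fun J o => hS _ _ _ (hm.restrict o).mem_closure
  exact S.add_mem ha hb

end SemiTambaraFunctor

/-! ### Subsets of fibres of a given size -/

namespace FinGSet

open scoped Pointwise

variable {G : Type u} [Group G] {X Y : FinGSet.{u} G} {f : X →[G] Y} {n : ℕ}

/-- The subset `U` has `n` elements, all in the fibre of `f` at `y`. -/
def IsPart (f : X →[G] Y) (n : ℕ) (y : Y) (U : Set X) : Prop :=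
  (∀ w ∈ U, f w = y) ∧ U.ncard = n

theorem IsPart.smul (γ : G) {y : Y} {U : Set X} (h : IsPart f n y U) :
    IsPart f n (γ • y) (γ • U) := by
  refine ⟨?_, by rw [Set.ncard_smul_set, h.2]⟩
  rintro _ ⟨w, hw, rfl⟩
  change f (γ • w) = _
  rw [map_smul, h.1 w hw]

theorem IsPart.smul' (γ : G) {x : X} {U : Set X} (h : IsPart f n (f x) U) :
    IsPart f n (f (γ • x)) (γ • U) := by
  rw [map_smul]
  exact h.smul γ

theorem IsPart.insert {x : X} {U : Set X} (h : IsPart f n (f x) U) (hx : x ∉ U) :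
    IsPart f (n + 1) (f x) (insert x U) := by
  refine ⟨?_, by rw [Set.ncard_insert_of_notMem hx, h.2]⟩
  rintro w (rfl | hw)
  · rfl
  · exact h.1 w hw

variable (f n)

/-- The pairs `(y, U)` of a point `y` and an `n`-element subset `U` of its fibre. -/
def parts : FinGSet.{u} G := ofSub ⟨Y × Set X⟩
  { carrier := {p | IsPart f n p.1 p.2}
    smul_mem' := fun γ _ h => h.smul γ }

/-- The pairs `(x, U)` of an `n`-element subset `U` of a fibre and a point `x ∈ U`. -/
def pointedParts : FinGSet.{u} G := ofSub ⟨X × Set X⟩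
  { carrier := {p | p.1 ∈ p.2 ∧ IsPart f n (f p.1) p.2}
    smul_mem' := fun γ _ h => ⟨Set.smul_mem_smul_set_iff.2 h.1, h.2.smul' γ⟩ }

/-- The pairs `(x, U)` of an `n`-element subset `U` of a fibre and a point `x ∉ U` of this
fibre. -/
def copointedParts : FinGSet.{u} G := ofSub ⟨X × Set X⟩
  { carrier := {p | p.1 ∉ p.2 ∧ IsPart f n (f p.1) p.2}
    smul_mem' := fun γ _ h => ⟨fun h' => h.1 (Set.smul_mem_smul_set_iff.1 h'), h.2.smul' γ⟩ }

/-- The triples `(w, x, U)` of an `n`-element subset `U` of a fibre, a point `w ∈ U` and a point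
`x ∉ U` of this fibre. -/
def bipointedParts : FinGSet.{u} G := ofSub ⟨X × X × Set X⟩
  { carrier := {p | p.1 ∈ p.2.2 ∧ p.2.1 ∉ p.2.2 ∧ IsPart f n (f p.2.1) p.2.2}
    smul_mem' := fun γ _ h => ⟨Set.smul_mem_smul_set_iff.2 h.1,
      fun h' => h.2.1 (Set.smul_mem_smul_set_iff.1 h'), h.2.2.smul' γ⟩ }

/-- `(y, U) ↦ y`. -/
def partsMap : parts f n →[G] Y where
  toFun p := p.1.1
  map_smul' _ _ := rfl

/-- `(x, U) ↦ x`. -/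
def pointedPartsFst : pointedParts f n →[G] X where
  toFun p := p.1.1
  map_smul' _ _ := rfl

/-- `(x, U) ↦ (f x, U)`. -/
def pointedPartsSnd : pointedParts f n →[G] parts f n where
  toFun p := ⟨(f p.1.1, p.1.2), p.2.2⟩
  map_smul' γ p := Subtype.ext (Prod.ext (map_smul f γ p.1.1) rfl)

/-- `(x, U) ↦ x`. -/
def copointedPartsFst : copointedParts f n →[G] X where
  toFun p := p.1.1
  map_smul' _ _ := rfl

/-- `(x, U) ↦ (f x, U)`. -/
def copointedPartsSnd : copointedParts f n →[G] parts f n where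
  toFun p := ⟨(f p.1.1, p.1.2), p.2.2⟩
  map_smul' γ p := Subtype.ext (Prod.ext (map_smul f γ p.1.1) rfl)

/-- `(x, U) ↦ (f x, insert x U)`. -/
def copointedPartsInsert : copointedParts f n →[G] parts f (n + 1) where
  toFun p := ⟨(f p.1.1, insert p.1.1 p.1.2), p.2.2.insert p.2.1⟩
  map_smul' γ p := Subtype.ext (Prod.ext (map_smul f γ p.1.1) (Set.smul_set_insert γ _ _).symm)

/-- `(x, U) ↦ (x, insert x U)`. -/
def copointedPartsInsertSelf : copointedParts f n →[G] pointedParts f (n + 1) where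
  toFun p := ⟨(p.1.1, insert p.1.1 p.1.2), Set.mem_insert _ _, p.2.2.insert p.2.1⟩
  map_smul' γ _ := Subtype.ext (Prod.ext rfl (Set.smul_set_insert γ _ _).symm)

/-- `(w, x, U) ↦ w`. -/
def bipointedPartsFst : bipointedParts f n →[G] X where
  toFun p := p.1.1
  map_smul' _ _ := rfl

/-- `(w, x, U) ↦ (x, U)`. -/
def bipointedPartsSnd : bipointedParts f n →[G] copointedParts f n where
  toFun p := ⟨p.1.2, p.2.2⟩
  map_smul' _ _ := rfl

variable {f n} in
theorem map_fst_of_bipointedParts (p : bipointedParts f n) : f p.1.1 = f p.1.2.1 :=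
  p.2.2.2.1 _ p.2.1

/-- `(w, x, U) ↦ (w, U)`. -/
def bipointedPartsForget : bipointedParts f n →[G] pointedParts f n where
  toFun p := ⟨(p.1.1, p.1.2.2), p.2.1, by
    change IsPart f _ (f p.1.1) _
    rw [map_fst_of_bipointedParts p]; exact p.2.2.2⟩
  map_smul' _ _ := rfl

/-- `(w, x, U) ↦ (w, insert x U)`. -/
def bipointedPartsInsert : bipointedParts f n →[G] pointedParts f (n + 1) where
  toFun p := ⟨(p.1.1, insert p.1.2.1 p.1.2.2), Set.mem_insert_of_mem _ p.2.1, by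
    change IsPart f _ (f p.1.1) _
    rw [map_fst_of_bipointedParts p]; exact p.2.2.2.insert p.2.2.1⟩
  map_smul' γ _ := Subtype.ext (Prod.ext rfl (Set.smul_set_insert γ _ _).symm)

/-- Given x and an (n + 1)-element subset U of its fibre, either x ∉ U, or U is obtained by adding x
to an n-element subset that misses x. -/
theorem isPullbackSq_parts : IsPullbackSq
    (desc (copointedPartsFst f (n + 1)) (copointedPartsFst f n))
    (desc (copointedPartsSnd f (n + 1)) (copointedPartsInsert f n)) (partsMap f (n + 1)) f := by
  refine ⟨by rintro (p | p) <;> rfl, ?_⟩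
  rintro ⟨⟨y, U⟩, hU⟩ x (rfl : y = f x)
  by_cases hx : x ∈ U
  · refine ⟨Sum.inr ⟨(x, U \ {x}), fun h => h.2 rfl, fun w hw => hU.1 w hw.1, ?_⟩,
      ⟨Subtype.ext (Prod.ext rfl (Set.insert_sdiff_self_of_mem hx)), rfl⟩, ?_⟩
    · rw [Set.ncard_sdiff_singleton_of_mem hx, hU.2]
      rfl
    · rintro (⟨⟨x', V⟩, h1, h2⟩ | ⟨⟨x', V⟩, h1, h2⟩) ⟨h, h'⟩
      · obtain rfl : x' = x := h'
        obtain rfl : V = U := congrArg (fun p => p.1.2) h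
        exact (h1 hx).elim
      · obtain rfl : x' = x := h'
        obtain rfl : insert x' V = U := congrArg (fun p => p.1.2) h
        refine congrArg Sum.inr (Subtype.ext (Prod.ext rfl ?_))
        exact (Set.insert_sdiff_self_of_notMem h1).symm
  · refine ⟨Sum.inl ⟨(x, U), hx, hU⟩, ⟨rfl, rfl⟩, ?_⟩
    rintro (⟨⟨x', V⟩, h1, h2⟩ | ⟨⟨x', V⟩, h1, h2⟩) ⟨h, h'⟩
    · obtain rfl : x' = x := h'
      obtain rfl : V = U := congrArg (fun p => p.1.2) h
      rfl
    · obtain rfl : x' = x := h'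
      obtain rfl : insert x' V = U := congrArg (fun p => p.1.2) h
      exact (hx (Set.mem_insert _ _)).elim

/-- The points w of U in the two cases of `isPullbackSq_parts`. When U = insert x V, either w = x or
w ∈ V; the piece w = x will contribute the factor a in `R_esymm_succ`. -/
theorem isPullbackSq_pointedParts : IsPullbackSq
    (desc ((inl _ _).comp (bipointedPartsSnd f (n + 1)))
      ((inr _ _).comp (desc (.id G) (bipointedPartsSnd f n))))
    (desc (bipointedPartsForget f (n + 1))
      (desc (copointedPartsInsertSelf f n) (bipointedPartsInsert f n)))
    (pointedPartsSnd f (n + 1)) (desc (copointedPartsSnd f (n + 1)) (copointedPartsInsert f n)) := by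
  constructor
  · rintro (p | p | p)
    · exact Subtype.ext (Prod.ext (map_fst_of_bipointedParts p) rfl)
    · rfl
    · exact Subtype.ext (Prod.ext (map_fst_of_bipointedParts p) rfl)
  · rintro ⟨⟨w, U⟩, hw, hU⟩ (⟨⟨x, V⟩, hx, hV⟩ | ⟨⟨x, V⟩, hx, hV⟩) h
    · obtain rfl : U = V := congrArg (fun p => p.1.2) h
      refine ⟨Sum.inl ⟨(w, x, U), hw, hx, hV⟩, ⟨rfl, rfl⟩, ?_⟩
      rintro (⟨⟨w', x', V'⟩, h1, h2, h3⟩ | p | p) ⟨h, h'⟩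
      · obtain rfl : w' = w := congrArg (fun p => p.1.1) h
        exact congrArg Sum.inl (Subtype.ext (Prod.ext rfl
          (congrArg Subtype.val (Sum.inl_injective h'))))
      · exact (Sum.inr_ne_inl h').elim
      · exact (Sum.inr_ne_inl h').elim
    · obtain rfl : U = insert x V := congrArg (fun p => p.1.2) h
      by_cases hwx : w = x
      · subst hwx
        refine ⟨Sum.inr (Sum.inl ⟨(w, V), hx, hV⟩), ⟨rfl, rfl⟩, ?_⟩
        rintro (p | ⟨⟨x', V'⟩, h1, h2⟩ | ⟨⟨w', x', V'⟩, h1, h2, h3⟩) ⟨h, h'⟩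
        · exact (Sum.inl_ne_inr h').elim
        · exact congrArg (fun p => Sum.inr (Sum.inl p)) (Sum.inr_injective h')
        · obtain rfl : w' = w := congrArg (fun p => p.1.1) h
          have h4 : (x', V') = (w', V) := congrArg Subtype.val (Sum.inr_injective h')
          obtain ⟨rfl, rfl⟩ := Prod.mk.inj h4
          exact (h2 h1).elim
      · have hwV : w ∈ V := hw.resolve_left hwx
        refine ⟨Sum.inr (Sum.inr ⟨(w, x, V), hwV, hx, hV⟩), ⟨rfl, rfl⟩, ?_⟩
        rintro (p | ⟨⟨x', V'⟩, h1, h2⟩ | ⟨⟨w', x', V'⟩, h1, h2, h3⟩) ⟨h, h'⟩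
        · exact (Sum.inl_ne_inr h').elim
        · have h4 : (x', V') = (x, V) := congrArg Subtype.val (Sum.inr_injective h')
          obtain rfl : x' = w := congrArg (fun p => p.1.1) h
          exact (hwx (congrArg Prod.fst h4)).elim
        · obtain rfl : w' = w := congrArg (fun p => p.1.1) h
          exact congrArg (fun p => Sum.inr (Sum.inr p)) (Subtype.ext (Prod.ext rfl
            (congrArg Subtype.val (Sum.inr_injective h'))))

theorem isEmpty_copointedParts : IsEmpty (copointedParts f (Nat.card X)) := by
  refine ⟨fun ⟨⟨x, U⟩, h1, h2⟩ => ?_⟩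
  have h : Nat.card {y : X // y ∈ U} < Nat.card X := Finite.card_subtype_lt h1
  exact h.ne h2.2

theorem isEmpty_bipointedParts_zero : IsEmpty (bipointedParts f 0) := by
  refine ⟨fun ⟨⟨w, x, U⟩, h1, h2, h3⟩ => ?_⟩
  obtain rfl : U = ∅ := (Set.ncard_eq_zero).1 h3.2
  exact h1

theorem bijective_copointedPartsFst_zero : Function.Bijective (copointedPartsFst f 0) := by
  constructor
  · rintro ⟨⟨x, U⟩, h1, h2⟩ ⟨⟨x', U'⟩, h1', h2'⟩ (rfl : x = x')
    obtain rfl : U = ∅ := (Set.ncard_eq_zero).1 h2.2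
    obtain rfl : U' = ∅ := (Set.ncard_eq_zero).1 h2'.2
    rfl
  · exact fun x => ⟨⟨(x, ∅), id, fun _ h => h.elim, Set.ncard_empty _⟩, rfl⟩

end FinGSet

/-! ### Elementary symmetric functions along fibres and integrality of restriction -/

namespace SemiTambaraFunctor

open FinGSet

variable {G : Type u} [Group G] {F : SemiTambaraFunctor.{u, v} G} {X Y : FinGSet.{u} G}

/-- The `n`-th elementary symmetric function of `a` along the fibres of `f`: the sum over the
`n`-element subsets of the fibres of the norms of `a`. -/
def esymm (f : X →[G] Y) (n : ℕ) (a : F.obj X) : F.obj Y :=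
  F.T (partsMap f n) (F.N (pointedPartsSnd f n) (F.R (pointedPartsFst f n) a))

/-- The `n`-th elementary symmetric function of `a` along the fibres of `f` with one point
removed. -/
def esymmCompl (f : X →[G] Y) (n : ℕ) (a : F.obj X) : F.obj X :=
  F.T (copointedPartsFst f n) (F.N (bipointedPartsSnd f n) (F.R (bipointedPartsFst f n) a))

/-- The analogue of e_{n+1}(all) = e_{n+1}(others) + a · e_n(others): subsets are sorted by whether
they contain the marked point, and Frobenius reciprocity pulls out the factor a. -/
theorem R_esymm_succ (f : X →[G] Y) (n : ℕ) (a : F.obj X) :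
    F.R f (esymm f (n + 1) a) = esymmCompl f (n + 1) a + a * esymmCompl f n a := by
  rw [esymm, F.R_T _ _ _ _ (isPullbackSq_parts f n), F.R_N _ _ _ _ (isPullbackSq_pointedParts f n),
    ← F.R_comp,
    show (pointedPartsFst f (n + 1)).comp (desc (bipointedPartsForget f (n + 1))
      (desc (copointedPartsInsertSelf f n) (bipointedPartsInsert f n))) =
        desc (bipointedPartsFst f (n + 1)) (desc (copointedPartsFst f n) (bipointedPartsFst f n)) by
      ext (p | p | p) <;> rfl,
    R_desc, R_desc, isPushforward_N.map_sum, T_desc, N_desc, F.N_id, T_R_mul]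
  rfl

theorem esymmCompl_zero (f : X →[G] Y) (a : F.obj X) : esymmCompl f 0 a = 1 := by
  have := isEmpty_bipointedParts_zero f
  rw [esymmCompl, N_of_isEmpty, ← R_one (copointedPartsFst f 0),
    isPushforward_T.map_R _ (bijective_copointedPartsFst_zero f)]

theorem esymmCompl_card (f : X →[G] Y) (a : F.obj X) : esymmCompl f (Nat.card X) a = 0 := by
  have := isEmpty_copointedParts f
  exact T_of_isEmpty _ _

end SemiTambaraFunctor

namespace TambaraFunctor

open FinGSet SemiTambaraFunctor

variable {G : Type u} [Group G] {F : TambaraFunctor.{u, v} G} {X Y : FinGSet.{u} G}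

/-- Restriction as a ring homomorphism. -/
def restriction (F : TambaraFunctor.{u, v} G) (f : X →[G] Y) : F.obj Y →+* F.obj X where
  toFun := F.R f
  map_one' := R_one f
  map_mul' := R_mul f
  map_zero' := R_zero f
  map_add' := R_add f

/-- Transfer as an additive homomorphism. -/
def transfer (F : TambaraFunctor.{u, v} G) (f : X →[G] Y) : F.obj X →+ F.obj Y where
  toFun := F.T f
  map_zero' := T_zero f
  map_add' := T_add f

open Polynomial in
/-- Restriction along any map is integral. -/
theorem isIntegralElem_restriction (f : X →[G] Y) (a : F.obj X) :
    (F.restriction f).IsIntegralElem a := by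
  -- The sign in `-a` makes these the coefficients of ∏(T - a_i) rather than of ∏(T + a_i).
  let c : ℕ → F.obj Y := fun n => esymm f (n + 1) (-a)
  have hc : ∀ n, F.restriction f (c n) = esymmCompl f (n + 1) (-a) + -a * esymmCompl f n (-a) :=
    fun n => R_esymm_succ f n (-a)
  set d := Nat.card X with hd
  -- Fibres may differ in size, so the degree is |X|; all that matters is that no d-element subset
  -- misses a point, so that `esymmCompl` vanishes at d. At a the sum telescopes to 0 - a ^ d.
  refine ⟨Polynomial.X ^ d + ∑ n ∈ Finset.range d, C (c n) * Polynomial.X ^ (d - 1 - n), monic_X_pow_add ?_, ?_⟩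
  · refine lt_of_le_of_lt (degree_sum_le _ _) ((Finset.sup_lt_iff (WithBot.bot_lt_coe d)).2 ?_)
    intro n hn
    refine lt_of_le_of_lt (degree_C_mul_X_pow_le _ _) ?_
    have := Finset.mem_range.1 hn
    exact WithBot.coe_lt_coe.2 (by omega : d - 1 - n < d)
  · rw [eval₂_add, eval₂_X_pow, eval₂_finsetSum]
    have h : ∀ n ∈ Finset.range d, eval₂ (F.restriction f) a (C (c n) * Polynomial.X ^ (d - 1 - n)) =
        esymmCompl f (n + 1) (-a) * a ^ (d - (n + 1)) - esymmCompl f n (-a) * a ^ (d - n) := by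
      intro n hn
      have hn' := Finset.mem_range.1 hn
      rw [eval₂_mul, eval₂_C, eval₂_X_pow, hc, show d - n = d - 1 - n + 1 by omega,
        show d - (n + 1) = d - 1 - n by omega, pow_succ]
      ring
    rw [Finset.sum_congr rfl h,
      Finset.sum_range_sub (fun n => esymmCompl f n (-a) * a ^ (d - n)) d, hd, esymmCompl_card,
      esymmCompl_zero]
    simp

end TambaraFunctor

/-! ### A finiteness criterion for rings generated by transfers -/

open Polynomial in
/-- A ring that is additively generated by finitely many transfers of finitely generated monoids of
integral elements is of finite type. -/
theorem Algebra.FiniteType.of_transfers {R : Type v} [CommRing R] {ι : Type w} [Finite ι]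
    {B : ι → Type v} [∀ i, CommRing (B i)] (ρ : ∀ i, R →+* B i) (τ : ∀ i, B i →+ R)
    (hτ : ∀ i r b, τ i (ρ i r * b) = r * τ i b) (s : ∀ i, Set (B i)) (hs : ∀ i, (s i).Finite)
    (hint : ∀ i, ∀ b ∈ s i, (ρ i).IsIntegralElem b)
    (hspan : ∀ r, r ∈ AddSubgroup.closure
      (⋃ i, τ i '' (Submonoid.closure (s i) : Set (B i)))) :
    Algebra.FiniteType ℤ R := by
  choose p hp hp' using hint
  have : ∀ i, Finite (s i) := hs
  -- Finitely many coefficients suffice: adjoining those of one integral equation for each generator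
  -- makes all generators integral over A.
  let C : Set R := ⋃ t : Σ i, s i, ((p t.1 t.2 t.2.2).coeffs : Set R)
  have hC : C.Finite := Set.finite_iUnion fun t => Finset.finite_toSet _
  let A := Algebra.adjoin ℤ C
  have hA : Algebra.FiniteType ℤ A :=
    A.fg_iff_finiteType.1 (Subalgebra.fg_def.2 ⟨C, hC, rfl⟩)
  let _ : ∀ i, Algebra A (B i) := fun i => ((ρ i).comp (algebraMap A R)).toAlgebra
  have hsm : ∀ i (a : A) (b : B i), a • b = ρ i a * b := fun i a b => Algebra.smul_def a b
  have hfg : ∀ i, (Algebra.adjoin A (s i)).toSubmodule.FG := fun i =>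
    fg_adjoin_of_finite (hs i) fun b hb => by
      have hsub : ((p i b hb).coeffs : Set R) ⊆ A.toSubring := fun c hc =>
        Algebra.subset_adjoin (Set.mem_iUnion.2 ⟨⟨i, b, hb⟩, hc⟩)
      refine ⟨(p i b hb).toSubring A.toSubring hsub, ?_, ?_⟩
      · exact (Polynomial.monic_toSubring _ _ _).2 (hp i b hb)
      · rw [← hp' i b hb]
        conv_rhs => rw [← Polynomial.map_toSubring (p i b hb) A.toSubring hsub]
        rw [Polynomial.eval₂_map]
        rfl
  let τ' : ∀ i, B i →ₗ[A] R := fun i =>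
    { τ i with
      map_smul' := fun a b => by
        change τ i (a • b) = a • τ i b
        rw [hsm, hτ]
        rfl }
  -- By A-linearity of transfers each image is a finite A-module, and by `hspan` these finitely many
  -- images generate R.
  have htop : (⊤ : Submodule A R) = ⨆ i, (Algebra.adjoin A (s i)).toSubmodule.map (τ' i) := by
    refine (_root_.eq_top_iff.2 ?_).symm
    intro r _
    have hle : AddSubgroup.closure (⋃ i, τ i '' (Submonoid.closure (s i) : Set (B i))) ≤
        (⨆ i, (Algebra.adjoin A (s i)).toSubmodule.map (τ' i)).toAddSubgroup := by
      rw [AddSubgroup.closure_le]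
      refine Set.iUnion_subset fun i => ?_
      rintro _ ⟨b, hb, rfl⟩
      refine Submodule.mem_iSup_of_mem i ⟨b, ?_, rfl⟩
      exact (Submonoid.closure_le (S := (Algebra.adjoin A (s i)).toSubmonoid)).2
        Algebra.subset_adjoin hb
    exact hle (hspan r)
  have hfin : Module.Finite A R := ⟨by
    rw [htop]
    exact Submodule.fg_iSup _ fun i => (hfg i).map _⟩
  exact Algebra.FiniteType.trans (S := A) hA inferInstance

/-! ### Finite generation of values, and the term model of the free functor -/

namespace TambaraFunctor

open FinGSet SemiTambaraFunctor

variable {G : Type u} [Group G] {A X Y : FinGSet.{u} G}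

/-- If every value of a Tambara functor consists of differences of transfers of norms of
restrictions of a single element, then its values are finitely generated rings. -/
theorem finiteType_of_isPolynomialDiff [Finite G] {F : TambaraFunctor.{u, v} G} (x : F.obj A)
    (h : ∀ a : F.obj Y, IsPolynomialDiff x a) : Algebra.FiniteType ℤ (F.obj Y) := by
  have : ∀ K : Subgroup G, Finite (orbit K →[G] Y) := fun K => DFunLike.finite _
  refine Algebra.FiniteType.of_transfers (ι := Σ K : Subgroup G, orbit K →[G] Y)
    (B := fun t => F.obj (orbit t.1)) (fun t => F.restriction t.2) (fun t => F.transfer t.2)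
    (fun t r b => T_R_mul t.2 r b) (fun t => orbitNorms x t.1) (fun t => finite_orbitNorms x t.1)
    (fun t b _ => isIntegralElem_restriction t.2 b) fun r => ?_
  have hmem : ∀ a : F.obj Y, IsPolynomial x a → a ∈ AddSubgroup.closure
      (⋃ t : Σ K : Subgroup G, orbit K →[G] Y, F.transfer t.2 ''
        (Submonoid.closure (orbitNorms x t.1) : Set (F.obj (orbit t.1)))) := fun a ha =>
    ha.mem_of_orbits (AddSubgroup.toAddSubmonoid _) fun K f m hm =>
      AddSubgroup.subset_closure (Set.mem_iUnion.2 ⟨⟨K, f⟩, m, hm, rfl⟩)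
  obtain ⟨u, v, hu, hv, rfl⟩ := h r
  have := AddSubgroup.sub_mem _ (hmem _ hu) (hmem _ hv)
  rwa [← (eq_sub_of_add_eq (G := F.obj Y) rfl : r = r + v - v)] at this

/-- Formal expressions in one generator at level `A`. -/
inductive Term (A : FinGSet.{u} G) : FinGSet.{u} G → Type (u + 1)
  | gen : Term A A
  | T {X Y : FinGSet.{u} G} (f : X →[G] Y) (s : Term A X) : Term A Y
  | N {X Y : FinGSet.{u} G} (f : X →[G] Y) (s : Term A X) : Term A Y
  | R {X Y : FinGSet.{u} G} (f : X →[G] Y) (s : Term A Y) : Term A X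
  | pt : Term A (empty G)
  | pair {X Y : FinGSet.{u} G} (s : Term A X) (t : Term A Y) : Term A (X.sum Y)
  | neg {X : FinGSet.{u} G} (s : Term A X) : Term A X

namespace Term

/-- The value of a formal expression in a Tambara functor. -/
noncomputable def eval (K : TambaraFunctor.{u, v} G) (b : K.obj A) :
    ∀ {X : FinGSet.{u} G}, Term A X → K.obj X
  | _, gen => b
  | _, T f s => K.T f (s.eval K b)
  | _, N f s => K.N f (s.eval K b)
  | _, R f s => K.R f (s.eval K b)
  | _, pt => K.emptyPt
  | _, pair s t => K.pair (s.eval K b) (t.eval K b)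
  | _, neg s => -s.eval K b

/-- Two formal expressions are equivalent if they have the same value for every element of every
Tambara functor. -/
def setoid (A X : FinGSet.{u} G) : Setoid (Term A X) where
  r s t := ∀ (K : TambaraFunctor.{u, v} G) (b : K.obj A), s.eval K b = t.eval K b
  iseqv := ⟨fun _ _ _ => rfl, fun h K b => (h K b).symm, fun h h' K b => (h K b).trans (h' K b)⟩

end Term

/-- The semi-Tambara functor of equivalence classes of formal expressions in one generator. -/
def freeSemi (A : FinGSet.{u} G) : SemiTambaraFunctor.{u, u + 1} G where
  obj X := Quotient (Term.setoid.{u, v} A X)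
  T f := Quotient.map (Term.T f) fun _ _ h K b => congrArg (K.T f) (h K b)
  N f := Quotient.map (Term.N f) fun _ _ h K b => congrArg (K.N f) (h K b)
  R f := Quotient.map (Term.R f) fun _ _ h K b => congrArg (K.R f) (h K b)
  T_id := by
    rintro X ⟨s⟩
    exact Quotient.sound fun K b => K.T_id _
  N_id := by
    rintro X ⟨s⟩
    exact Quotient.sound fun K b => K.N_id _
  R_id := by
    rintro X ⟨s⟩
    exact Quotient.sound fun K b => K.R_id _
  T_comp := by
    rintro X Y Z g f ⟨s⟩
    exact Quotient.sound fun K b => K.T_comp g f _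
  N_comp := by
    rintro X Y Z g f ⟨s⟩
    exact Quotient.sound fun K b => K.N_comp g f _
  R_comp := by
    rintro X Y Z g f ⟨s⟩
    exact Quotient.sound fun K b => K.R_comp g f _
  R_T := by
    rintro W X Y Z f' g' f g h ⟨s⟩
    exact Quotient.sound fun K b => K.R_T f' g' f g h _
  R_N := by
    rintro W X Y Z f' g' f g h ⟨s⟩
    exact Quotient.sound fun K b => K.R_N f' g' f g h _
  N_T := by
    rintro X Y Z f g ⟨s⟩
    exact Quotient.sound fun K b => K.N_T f g _
  unique_empty := ⟨⟨⟨⟦Term.pt⟧⟩, by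
    rintro ⟨s⟩
    exact Quotient.sound fun K b => eq_of_empty _ _⟩⟩
  bijective_sum X Y := by
    constructor
    · rintro ⟨s⟩ ⟨t⟩ h
      exact Quotient.sound fun K b => sum_ext (Quotient.exact (congrArg Prod.fst h) K b)
        (Quotient.exact (congrArg Prod.snd h) K b)
    -- The constructor `Term.pair` is there to supply this preimage, just as `Term.pt` supplies the
    -- point at the empty set and `Term.neg` the additive inverses.
    · rintro ⟨⟨s⟩, ⟨t⟩⟩
      exact ⟨⟦Term.pair s t⟧, Prod.ext (Quotient.sound fun K b => R_inl_pair _ _)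
        (Quotient.sound fun K b => R_inr_pair _ _)⟩

/-- The class of a formal expression. -/
def freeSemi.mk (s : Term A X) : (freeSemi.{u, v} A).obj X := Quotient.mk _ s

theorem freeSemi.mk_eq {s t : Term A X}
    (h : ∀ (K : TambaraFunctor.{u, v} G) (b : K.obj A), s.eval K b = t.eval K b) :
    freeSemi.mk.{u, v} s = freeSemi.mk t :=
  Quotient.sound h

theorem freeSemi.pair_mk (s : Term A X) (t : Term A Y) :
    (freeSemi.{u, v} A).pair (mk s) (mk t) = mk (s.pair t) := by
  refine sum_ext ?_ ?_
  · rw [R_inl_pair]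
    exact mk_eq fun K b => (R_inl_pair (s.eval K b) (t.eval K b)).symm
  · rw [R_inr_pair]
    exact mk_eq fun K b => (R_inr_pair (s.eval K b) (t.eval K b)).symm

theorem freeSemi.emptyPt_eq : (freeSemi.{u, v} A).emptyPt = mk Term.pt := eq_of_empty _ _

theorem freeSemi.mk_add_mk_neg (s : Term A X) : mk.{u, v} s + mk s.neg = 0 := by
  rw [add_def, zero_def, pair_mk, emptyPt_eq]
  exact mk_eq fun K b => add_neg_cancel (s.eval K b)

/-- The Tambara functor of equivalence classes of formal expressions in one generator. -/
def freeLarge (A : FinGSet.{u} G) : TambaraFunctor.{u, u + 1} G where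
  toSemiTambaraFunctor := freeSemi.{u, v} A
  hasAddInverses := by
    rintro X ⟨s⟩
    exact ⟨freeSemi.mk s.neg, freeSemi.mk_add_mk_neg s⟩

/-- Differences of polynomials contain the generator and are closed under every constructor of
`Term`. -/
theorem freeSemi.isPolynomialDiff_mk (s : Term A X) :
    IsPolynomialDiff (mk.{u, v} (Term.gen : Term A A)) (mk s) := by
  induction s with
  | gen => exact .of_isPolynomial IsMonomial.self.isPolynomial
  | T f s ih => exact ih.transfer f
  | N f s ih => exact ih.norm f
  | R f s ih => exact ih.restrict f
  | pt =>
    rw [← emptyPt_eq, eq_of_empty (freeSemi.{u, v} A).emptyPt 0]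
    exact .of_isPolynomial .zero
  | pair s t ih ih' =>
    rw [← pair_mk]
    exact ih.pair ih'
  | neg s ih => exact ih.of_add_eq_zero (mk_add_mk_neg s)

theorem finiteType_freeLarge [Finite G] : Algebra.FiniteType ℤ ((freeLarge.{u, v} A).obj X) :=
  finiteType_of_isPolynomialDiff (F := freeLarge.{u, v} A) (freeSemi.mk Term.gen) fun a =>
    Quotient.inductionOn a freeSemi.isPolynomialDiff_mk

/-- A finitely generated ring is a quotient of a countable polynomial ring. Countability is what
allows the term model to move to any universe. -/
theorem countable_freeLarge [Finite G] : Countable ((freeLarge.{u, v} A).obj X) := by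
  obtain ⟨n, f, hf⟩ := Algebra.FiniteType.iff_quotient_mvPolynomial''.1
    (finiteType_freeLarge (A := A) (X := X))
  have : Countable (MvPolynomial (Fin n) ℤ) :=
    Cardinal.mk_le_aleph0_iff.1 (MvPolynomial.cardinalMk_le_max_lift.trans (by simp))
  exact hf.countable

end TambaraFunctor

/-! ### Transport along bijections -/

namespace SemiTambaraFunctor

open FinGSet

variable {G : Type u} [Group G] {X Y : FinGSet.{u} G}

/-- Transport of a semi-Tambara functor along bijections. -/
def transport (F : SemiTambaraFunctor.{u, w} G) {O : FinGSet.{u} G → Type v}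
    (e : ∀ X, F.obj X ≃ O X) : SemiTambaraFunctor.{u, v} G where
  obj := O
  T f a := e _ (F.T f ((e _).symm a))
  N f a := e _ (F.N f ((e _).symm a))
  R f a := e _ (F.R f ((e _).symm a))
  T_id a := by simp [F.T_id]
  N_id a := by simp [F.N_id]
  R_id a := by simp [F.R_id]
  T_comp g f a := by simp [F.T_comp]
  N_comp g f a := by simp [F.N_comp]
  R_comp g f a := by simp [F.R_comp]
  R_T f' g' f g h a := by simp [F.R_T f' g' f g h]
  R_N f' g' f g h a := by simp [F.R_N f' g' f g h]
  N_T f g a := by simp [F.N_T]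
  unique_empty := F.unique_empty.map fun h => @Equiv.unique _ _ h (e (empty G)).symm
  bijective_sum X Y := by
    have h := (((e X).prodCongr (e Y)).bijective.comp (F.bijective_sum X Y)).comp
      (e (X.sum Y)).symm.bijective
    exact h

variable (F : SemiTambaraFunctor.{u, w} G) {O : FinGSet.{u} G → Type v} (e : ∀ X, F.obj X ≃ O X)

/-- The bijections defining a transported semi-Tambara functor. -/
def toTransport (X : FinGSet.{u} G) : F.obj X ≃ (F.transport e).obj X := e X

theorem toTransport_T (f : X →[G] Y) (a : F.obj X) :
    F.toTransport e Y (F.T f a) = (F.transport e).T f (F.toTransport e X a) :=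
  congrArg (fun b => e Y (F.T f b)) ((e X).symm_apply_apply a).symm

theorem toTransport_N (f : X →[G] Y) (a : F.obj X) :
    F.toTransport e Y (F.N f a) = (F.transport e).N f (F.toTransport e X a) :=
  congrArg (fun b => e Y (F.N f b)) ((e X).symm_apply_apply a).symm

theorem toTransport_R (f : X →[G] Y) (a : F.obj Y) :
    F.toTransport e X (F.R f a) = (F.transport e).R f (F.toTransport e Y a) :=
  congrArg (fun b => e X (F.R f b)) ((e Y).symm_apply_apply a).symm

theorem toTransport_pair (a : F.obj X) (b : F.obj Y) :
    F.toTransport e _ (F.pair a b) =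
      (F.transport e).pair (F.toTransport e X a) (F.toTransport e Y b) := by
  refine sum_ext ?_ ?_ <;> rw [← toTransport_R]
  · rw [R_inl_pair, R_inl_pair]
  · rw [R_inr_pair, R_inr_pair]

/-- The bijections defining a transported semi-Tambara functor are homomorphisms. -/
def transportRingHom (X : FinGSet.{u} G) : F.obj X →+* (F.transport e).obj X where
  toFun := F.toTransport e X
  map_one' := (F.toTransport_N e _ _).trans (congrArg _ (eq_of_empty _ _))
  map_zero' := (F.toTransport_T e _ _).trans (congrArg _ (eq_of_empty _ _))
  map_mul' a b := (F.toTransport_N e _ _).trans (congrArg _ (F.toTransport_pair e a b))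
  map_add' a b := (F.toTransport_T e _ _).trans (congrArg _ (F.toTransport_pair e a b))

end SemiTambaraFunctor

/-! ### The free functor in the given universe and its universal property -/

namespace TambaraFunctor

open FinGSet SemiTambaraFunctor

variable {G : Type u} [Group G] {A X Y : FinGSet.{u} G}

/-- Transport of a Tambara functor along bijections. -/
def transport (F : TambaraFunctor.{u, w} G) {O : FinGSet.{u} G → Type v}
    (e : ∀ X, F.obj X ≃ O X) : TambaraFunctor.{u, v} G where
  toSemiTambaraFunctor := F.toSemiTambaraFunctor.transport e
  hasAddInverses X a := by
    obtain ⟨b, hb⟩ := F.hasAddInverses X ((e X).symm a)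
    refine ⟨e X b, ?_⟩
    have h := congrArg (F.toSemiTambaraFunctor.transportRingHom e X) hb
    rw [map_add, map_zero] at h
    refine Eq.trans ?_ h
    congr 1
    exact ((e X).apply_symm_apply a).symm

theorem finiteType_transport (F : TambaraFunctor.{u, w} G) {O : FinGSet.{u} G → Type v}
    (e : ∀ X, F.obj X ≃ O X) (h : Algebra.FiniteType ℤ (F.obj X)) :
    Algebra.FiniteType ℤ ((F.transport e).obj X) := by
  let φ : F.obj X →+* (F.transport e).obj X := F.toSemiTambaraFunctor.transportRingHom e X
  exact h.of_surjective φ.toIntAlgHom (e X).surjective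

namespace Hom

variable {K K' K'' : TambaraFunctor.{u, v} G}

theorem ext {φ ψ : Hom K K'} (h : ∀ X a, φ.app X a = ψ.app X a) : φ = ψ := by
  obtain ⟨f, _, _, _⟩ := φ
  obtain ⟨g, _, _, _⟩ := ψ
  obtain rfl : f = g := funext fun X => funext (h X)
  rfl

/-- The identity morphism. -/
def id (K : TambaraFunctor.{u, v} G) : Hom K K where
  app _ a := a
  app_T _ _ := rfl
  app_N _ _ := rfl
  app_R _ _ := rfl

/-- The composite of two morphisms. -/
def comp (ψ : Hom K' K'') (φ : Hom K K') : Hom K K'' where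
  app X a := ψ.app X (φ.app X a)
  app_T f a := by rw [φ.app_T, ψ.app_T]
  app_N f a := by rw [φ.app_N, ψ.app_N]
  app_R f a := by rw [φ.app_R, ψ.app_R]

variable (φ : Hom K K')

theorem app_pair (a : K.obj X) (b : K.obj Y) :
    φ.app _ (K.pair a b) = K'.pair (φ.app X a) (φ.app Y b) := by
  refine sum_ext ?_ ?_ <;> rw [← φ.app_R]
  · rw [R_inl_pair, R_inl_pair]
  · rw [R_inr_pair, R_inr_pair]

/-- The components of a morphism are ring homomorphisms. -/
def ringHom (X : FinGSet.{u} G) : K.obj X →+* K'.obj X where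
  toFun := φ.app X
  map_one' := (φ.app_N _ _).trans (congrArg _ (eq_of_empty _ _))
  map_zero' := (φ.app_T _ _).trans (congrArg _ (eq_of_empty _ _))
  map_mul' a b := (φ.app_N _ _).trans (congrArg _ (φ.app_pair a b))
  map_add' a b := (φ.app_T _ _).trans (congrArg _ (φ.app_pair a b))

end Hom

instance small_freeLarge [Finite G] : Small.{v} ((freeLarge.{u, w} A).obj X) :=
  have := countable_freeLarge.{u, w} (A := A) (X := X)
  inferInstance

/-- The value of a class of formal expressions in a Tambara functor. -/
noncomputable def freeSemi.eval (K : TambaraFunctor.{u, v} G) (b : K.obj A) :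
    (freeSemi.{u, v} A).obj X → K.obj X :=
  Quotient.lift (fun s => s.eval K b) fun s t (h : (Term.setoid.{u, v} A X).r s t) => h K b

/-- The free Tambara functor on one generator. -/
noncomputable def free [Finite G] (A : FinGSet.{u} G) : TambaraFunctor.{u, v} G :=
  (freeLarge.{u, v} A).transport fun X => equivShrink.{v} ((freeLarge.{u, v} A).obj X)

/-- The comparison of the two models of the free Tambara functor. -/
noncomputable def freeEquiv [Finite G] (A X : FinGSet.{u} G) :
    (freeSemi.{u, v} A).obj X ≃ (free.{u, v} A).obj X :=
  (freeSemi.{u, v} A).toTransport _ X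

section

variable [Finite G]

theorem freeEquiv_T (f : X →[G] Y) (a : (freeSemi.{u, v} A).obj X) :
    freeEquiv A Y ((freeSemi A).T f a) = (free A).T f (freeEquiv A X a) :=
  toTransport_T _ _ f a

theorem freeEquiv_N (f : X →[G] Y) (a : (freeSemi.{u, v} A).obj X) :
    freeEquiv A Y ((freeSemi A).N f a) = (free A).N f (freeEquiv A X a) :=
  toTransport_N _ _ f a

theorem freeEquiv_R (f : X →[G] Y) (a : (freeSemi.{u, v} A).obj Y) :
    freeEquiv A X ((freeSemi A).R f a) = (free A).R f (freeEquiv A Y a) :=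
  toTransport_R _ _ f a

/-- The generator of the free Tambara functor. -/
noncomputable def freeGen (A : FinGSet.{u} G) : (free.{u, v} A).obj A :=
  freeEquiv A A (freeSemi.mk Term.gen)

theorem finiteType_free : Algebra.FiniteType ℤ ((free.{u, v} A).obj X) :=
  finiteType_transport _ _ finiteType_freeLarge

/-- The morphism out of the free Tambara functor determined by an element. -/
noncomputable def freeLift (K : TambaraFunctor.{u, v} G) (b : K.obj A) : Hom (free.{u, v} A) K where
  app X a := freeSemi.eval K b ((freeEquiv A X).symm a)
  app_T {X Y} f a := by
    obtain ⟨s, rfl⟩ := (freeEquiv A X).surjective a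
    rw [← freeEquiv_T, Equiv.symm_apply_apply, Equiv.symm_apply_apply]
    exact Quotient.inductionOn s fun _ => rfl
  app_N {X Y} f a := by
    obtain ⟨s, rfl⟩ := (freeEquiv A X).surjective a
    rw [← freeEquiv_N, Equiv.symm_apply_apply, Equiv.symm_apply_apply]
    exact Quotient.inductionOn s fun _ => rfl
  app_R {X Y} f a := by
    obtain ⟨s, rfl⟩ := (freeEquiv A Y).surjective a
    rw [← freeEquiv_R, Equiv.symm_apply_apply, Equiv.symm_apply_apply]
    exact Quotient.inductionOn s fun _ => rfl

theorem freeLift_freeGen (K : TambaraFunctor.{u, v} G) (b : K.obj A) :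
    (freeLift K b).app A (freeGen A) = b := by
  change freeSemi.eval K b ((freeEquiv A A).symm (freeEquiv A A (freeSemi.mk Term.gen))) = b
  rw [Equiv.symm_apply_apply]
  rfl

/-- The comparison of the two models of the free Tambara functor, as a ring homomorphism. -/
noncomputable def freeRingHom (A X : FinGSet.{u} G) :
    (freeSemi.{u, v} A).obj X →+* (free.{u, v} A).obj X :=
  (freeSemi.{u, v} A).transportRingHom _ X

/-- A morphism is determined by the image of the generator, which gives uniqueness. Compatibility
with points, pairs and negatives is not part of `Hom`; it follows from compatibility with transfers,
norms and restrictions. -/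
theorem app_freeEquiv_mk {K : TambaraFunctor.{u, v} G} (φ : Hom (free.{u, v} A) K)
    (s : Term A X) :
    φ.app X (freeEquiv A X (freeSemi.mk s)) = s.eval K (φ.app A (freeGen A)) := by
  induction s with
  | gen => rfl
  | T f s ih =>
    rw [Term.eval, ← ih, ← φ.app_T, ← freeEquiv_T]
    rfl
  | N f s ih =>
    rw [Term.eval, ← ih, ← φ.app_N, ← freeEquiv_N]
    rfl
  | R f s ih =>
    rw [Term.eval, ← ih, ← φ.app_R, ← freeEquiv_R]
    rfl
  | pt => exact eq_of_empty _ _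
  | pair s t ih ih' =>
    rw [Term.eval, ← ih, ← ih', ← φ.app_pair, ← freeSemi.pair_mk]
    exact congrArg _ (toTransport_pair _ _ _ _)
  | @neg X s ih =>
    have h := congrArg (fun a => φ.ringHom X (freeRingHom A X a)) (freeSemi.mk_add_mk_neg s)
    simp only [map_add, map_zero] at h
    rw [Term.eval, ← ih]
    exact eq_neg_of_add_eq_zero_right h

theorem existsUnique_hom_free (K : TambaraFunctor.{u, v} G) (b : K.obj A) :
    ∃! φ : Hom (free.{u, v} A) K, φ.app A (freeGen A) = b := by
  refine ⟨freeLift K b, freeLift_freeGen K b, ?_⟩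
  rintro φ rfl
  refine Hom.ext fun X a => ?_
  obtain ⟨s, rfl⟩ := (freeEquiv A X).surjective a
  refine Quotient.inductionOn s fun s => ?_
  exact (app_freeEquiv_mk φ s).trans
    ((app_freeEquiv_mk _ s).trans (by rw [freeLift_freeGen])).symm

/-- The two universal properties give morphisms in both directions matching the generators. Their
composite on F is the identity, so the values of F are ring quotients of those of the constructed
model. -/
theorem IsFree.finiteType {H : Subgroup G} {F : TambaraFunctor.{u, v} G} {x : F.obj (orbit H)}
    (h : IsFree H F x) (X : FinGSet.{u} G) : Algebra.FiniteType ℤ (F.obj X) := by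
  obtain ⟨φ, hφ, -⟩ := h (free (orbit H)) (freeGen (orbit H))
  let ψ := freeLift F x
  have hψ : ψ.comp φ = Hom.id F := (h F x).unique
    ((congrArg (ψ.app _) hφ).trans (freeLift_freeGen F x)) rfl
  refine (finiteType_free (A := orbit H) (X := X)).of_surjective (ψ.ringHom X).toIntAlgHom
    fun a => ⟨φ.app X a, ?_⟩
  exact congrArg (fun χ : Hom F F => χ.app X a) hψ

end

end TambaraFunctor

theorem mainTheorem4 (G : Type u) [Group G] [Finite G] :
    (∃ (A : TambaraFunctor.{u, v} G) (x : A.obj (FinGSet.orbit (⊤ : Subgroup G))),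
      TambaraFunctor.IsFree ⊤ A x) ∧
    ∀ (A : TambaraFunctor.{u, v} G) (x : A.obj (FinGSet.orbit (⊤ : Subgroup G))),
      TambaraFunctor.IsFree ⊤ A x →
        ∀ H : Subgroup G, Algebra.FiniteType ℤ (A.obj (FinGSet.orbit H)) :=
  ⟨⟨TambaraFunctor.free _, TambaraFunctor.freeGen _, TambaraFunctor.existsUnique_hom_free⟩,
    fun _ _ h _ => h.finiteType _⟩
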